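/- **Setting.** Let $\Omega\subset\mathbb R^d$ be a convex cone with non-empty interior. Let $\mu$ be the measure on $\Omega$ with polar decomposition $d\mu(r\zeta)=r^{2a-1}\,dr\,Q(\zeta)\,d\sigma(\zeta)$, where $a>0$, $\sigma$ is the surface measure of the unit sphere $S^{d-1}$, $Q\in L^1(S^{d-1})$, $Q\ge 0$ and $Q\neq 0$. Let $\mathcal K:\Omega\times\Omega\to\mathbb C$ be continuous, bounded, $|\mathcal K(x,\xi)|\le c_{\mathcal K}$, and homogeneous, $\mathcal K(\lambda x,\xi)=\mathcal K(x,\lambda\xi)$ for $\lambda>0$. Put $\mathcal T h(\xi)=\int_\Omega h(x)\mathcal K(x,\xi)\,d\mu(x)$ for $h\in L^1(\Omega,\mu)$, and assume Parseval's theorem: $\langle\mathcal Tf,\mathcal Tg\rangle_\mu=\langle f,g\rangle_\mu$ for all (restrictions to $\Omega$ of) Schwartz functions $f,g$, where $\langle f,g\rangle_\mu=\int_\Omega f\bar g\,d\mu$. Let $\phi,\psi\in L^2(\Omega,\mu)\cap L^\infty(\Omega,\mu)$ with $\|\phi\|_{2,\mu}=\|\psi\|_{2,\mu}=1$. For a symbol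 $\sigma$, the wavelet multiplier $P_{\sigma,\phi,\psi}$ is the bounded operator on $L^2(\Omega,\mu)$ such that, for all $f,g\in L^2(\Omega,\mu)$, $$\langle P_{\sigma,\phi,\psi}f,g\rangle_\mu=\int_\Omega\sigma\,\mathcal T(\phi f)\,\overline{\mathcal T(\psi g)}\,d\mu ,$$ the integral being absolutely convergent. For $1\le p<\infty$, the Schatten class $S_p$ is the set of compact operators $A$ whose singular values (the eigenvalues of $|A|=\sqrt{A^*A}$, with multiplicity) lie in $\ell^p$, with $\|A\|_{S_p}$ the $\ell^p$ norm of the singular values; $S_\infty$ is the set of bounded operators with the operator norm. **Theorem C.** 0. $\mathcal T$ extends from Schwartz functions to a linear isometry $U$ of $L^2(\Omega,\mu)$ into itself. For $1\le p\le\infty$ and $\sigma\in L^p(\Omega,\mu)$, the operator $P_{\sigma,\phi,\psi}$ exists and is unique, and $P_{\sigma,\phi,\psi}=\bar\psi F_\sigma\phi$ in the following sense: for $f\in L^2(\Omega,\mu)$, $P_{\sigma,\phi,\psi}f=\bar\psi\,F_\sigma(\phi f)$ almost everywhere with $F_\sigma h(x)=\int_\Omega\sigma(\xi)\mathcal Th(\xi)\overline{\mathcal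 K(x,\xi)}\,d\mu(\xi)$, $h=\phi f$, whenever $\sigma\,\mathcal Th\in L^1(\Omega,\mu)$, and with $F_\sigma h=U^*(\sigma\,Uh)$, $h=\phi f$, whenever $\sigma\,Uh\in L^2(\Omega,\mu)$ (here $U^*=U^{-1}$ if $U$ is onto). 1. For $1\le p\le\infty$ and $\sigma\in L^p(\Omega,\mu)$, the operator $P_{\sigma,\phi,\psi}$ is in $S_p$, and both $\|P_{\sigma,\phi,\psi}\|_{S_p}$ and the operator norm $\|P_{\sigma,\phi,\psi}\|_{S_\infty}$ are at most $$c_{\mathcal K}^{2/p}\,\bigl(\|\phi\|_\infty\|\psi\|_\infty\bigr)^{1-1/p}\,\|\sigma\|_{p,\mu}.$$ In particular $\|P_{\sigma,\phi,\psi}\|_{S_p}\le c_{\mathcal K}^{2/p}\|\sigma\|_{p,\mu}$ if $\|\phi\|_\infty\|\psi\|_\infty=1$. 2. If $\sigma\in L^1(\Omega,\mu)$, then $P_{\sigma,\phi,\psi}$ is trace class, $\|P_{\sigma,\phi,\psi}\|_{S_1}\le c_{\mathcal K}^2\|\sigma\|_{1,\mu}$, and for every orthonormal basis $(\varphi_n)$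 of $L^2(\Omega,\mu)$ $$\operatorname{tr}(P_{\sigma,\phi,\psi})=\sum_n\langle P_{\sigma,\phi,\psi}\varphi_n,\varphi_n\rangle_\mu=\int_\Omega\sigma(\xi)\,\bigl\langle\overline{\psi\,\mathcal K(\cdot,\xi)},\overline{\phi\,\mathcal K(\cdot,\xi)}\bigr\rangle_\mu\,d\mu(\xi),$$ where the sum converges unconditionally and the integral absolutely. 3. Suppose $\|\phi\|_\infty\|\psi\|_\infty=1$. Let $S,\Sigma\subset\Omega$ be measurable and let $\varepsilon_1,\varepsilon_2\ge0$ with $\varepsilon_1+\varepsilon_2<1$. If there is a nonzero $f\in L^2(\Omega,\mu)$ with $\|P_{\chi_S,\phi,\psi}f-f\|_{2,\mu}\le\varepsilon_1\|f\|_{2,\mu}$ and $\|P_{\chi_\Sigma,\phi,\psi}f-f\|_{2,\mu}\le\varepsilon_2\|f\|_{2,\mu}$, then $$\mu(S)\,\mu(\Sigma)\ge c_{\mathcal K}^{-4}\,(1-\varepsilon_1-\varepsilon_2).$$ -/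

import Mathlib

open MeasureTheory Set
open scoped ENNReal NNReal ComplexConjugate InnerProductSpace SchwartzMap

noncomputable section

namespace WaveletMultiplier

/-- The Euclidean space `ℝ^d`. -/
abbrev E (d : ℕ) : Type := EuclideanSpace ℝ (Fin d)

/-- The measure on the cone `Ω` with polar decomposition
`dμ(rζ) = r^(2a-1) dr Q(ζ) dσ(ζ)`, where `σ` is the surface measure of the unit sphere.
It is regarded as a measure on `ℝ^d` that does not charge the complement of `Ω`, so that
`L^p(Ω, μ)` is `Lp ℂ p (coneMeasure Ω a Q)`. -/
def coneMeasure {d : ℕ} (Ω : ConvexCone ℝ (E d)) (a : ℝ) (Q : Metric.sphere (0 : E d) 1 → ℝ) :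
    Measure (E d) :=
  (Measure.map (fun z : Metric.sphere (0 : E d) 1 × ℝ => z.2 • (z.1 : E d))
    (((volume : Measure (E d)).toSphere.withDensity fun ζ => ENNReal.ofReal (Q ζ)).prod
      (((volume : Measure ℝ).restrict (Ioi 0)).withDensity
        fun r => ENNReal.ofReal (r ^ (2 * a - 1))))).restrict (Ω : Set (E d))

section Transform

variable {X : Type*} [MeasurableSpace X]

/-- The integral transform `𝒯 h (ξ) = ∫ h(x) K(x, ξ) dμ(x)` (for integrable `h`). -/
def transform (K : X → X → ℂ) (μ : Measure X) (h : X → ℂ) (ξ : X) : ℂ :=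
  ∫ x, h x * K x ξ ∂μ

/-- The pseudo-differential operator (multiplier)
`F_σ h (x) = ∫ σ(ξ) 𝒯h(ξ) conj K(x, ξ) dμ(ξ)`
(for integrable `h` such that `σ 𝒯h` is integrable). -/
def multiplierIntegral (K : X → X → ℂ) (μ : Measure X) (σ h : X → ℂ) (x : X) : ℂ :=
  ∫ ξ, σ ξ * transform K μ h ξ * conj (K x ξ) ∂μ

/-- `P` is the wavelet multiplier `P_{σ,φ,ψ}`: the bounded operator on `L²(μ)` with
`⟨P f, g⟩ = ⟨σ 𝒯(φ f), 𝒯(ψ g)⟩` for all `f, g` in `L²(μ)`, the right-hand side being an absolutely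
convergent integral. The products `φ f` and `ψ g` are integrable when `φ, ψ` are in `L²`. -/
def IsWaveletMultiplier (K : X → X → ℂ) (μ : Measure X) (φ ψ σ : X → ℂ)
    (P : Lp ℂ 2 μ →L[ℂ] Lp ℂ 2 μ) : Prop :=
  ∀ f g : Lp ℂ 2 μ,
    Integrable (fun ξ => σ ξ * transform K μ (fun x => φ x * f x) ξ *
      conj (transform K μ (fun x => ψ x * g x) ξ)) μ ∧
    ⟪g, P f⟫_ℂ = ∫ ξ, σ ξ * transform K μ (fun x => φ x * f x) ξ *
      conj (transform K μ (fun x => ψ x * g x) ξ) ∂μ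

end Transform

/-- `U` is an extension to `L²(μ)` of the integral transform on (restrictions of) Schwartz
functions. -/
def ExtendsTransform {d : ℕ} (K : E d → E d → ℂ) (μ : Measure (E d))
    (U : Lp ℂ 2 μ →ₗᵢ[ℂ] Lp ℂ 2 μ) : Prop :=
  ∀ (h : 𝓢(E d, ℂ)) (f : Lp ℂ 2 μ), f =ᵐ[μ] h → U f =ᵐ[μ] transform K μ h

section Operators

universe u

variable {H : Type u} [NormedAddCommGroup H] [InnerProductSpace ℂ H] [CompleteSpace H]

/-- The Schatten norm with values in `[0, ∞]`. For `p = ∞` it is the operator norm; for `p < ∞` it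
is the `ℓ^p` norm of the singular values of `A`, that is of the eigenvalues `t ≥ 0` of
`|A| = √(A* A)`, counted with multiplicity `dim ker (|A| - t)`. It is meant for compact `A` if
`p < ∞`; then the eigenspaces for `t > 0` have finite dimension. -/
def schattenNorm (p : ℝ≥0∞) (A : H →L[ℂ] H) : ℝ≥0∞ :=
  if p = ∞ then ‖A‖ₑ
  else (∑' t : ℝ≥0,
    (Module.finrank ℂ (Module.End.eigenspace ((CFC.abs A : H →L[ℂ] H) : H →ₗ[ℂ] H)
      ((t : ℝ) : ℂ)) : ℝ≥0∞) * (t : ℝ≥0∞) ^ p.toReal) ^ (p.toReal)⁻¹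

/-- The Schatten class `S_p`: all bounded operators if `p = ∞`, and the compact operators whose
singular values lie in `ℓ^p` if `p < ∞`. -/
def MemSchatten (p : ℝ≥0∞) (A : H →L[ℂ] H) : Prop :=
  p = ∞ ∨ (IsCompactOperator A ∧ schattenNorm p A < ∞)

/-- The trace of `A` is `t`: `∑ ⟨A e, e⟩ = t` over every orthonormal basis. -/
def HasTrace (A : H →L[ℂ] H) (t : ℂ) : Prop :=
  ∀ (ι : Type u) (b : HilbertBasis ι ℂ H), HasSum (fun i => ⟪b i, A (b i)⟫_ℂ) t

/-- `f` is nonzero and `ε`-localized with respect to `L`. -/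
def IsLocalized (ε : ℝ) (L : H →L[ℂ] H) (f : H) : Prop :=
  f ≠ 0 ∧ ‖L f - f‖ ≤ ε * ‖f‖

end Operators

end WaveletMultiplier

end

/-! The proof is a direct estimate, without interpolation. Write `F f` for the transform of `φ f`
and `G g` for that of `ψ g`. Two facts about `F` matter. Pointwise, `F f ξ` is the inner product of
`f` with the conjugate of `φ K(·, ξ)`, a vector of norm at most `c` because `‖φ‖₂ = 1`. Globally,
Parseval gives `‖F f‖₂ = ‖φ f‖₂ ≤ ‖φ‖_∞ ‖f‖`. The same holds for `G`; `BoundedSampling` records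
these facts, and most of the argument uses nothing else.

For orthonormal families `e`, `u`, put `w i = |F (e i)| |G (u i)|`. Cauchy–Schwarz and Bessel give
`∑ w i ≤ c²` almost everywhere, and Cauchy–Schwarz in `L²` gives `∫ w i ≤ A B` with `A = ‖φ‖_∞`, `B
= ‖ψ‖_∞`. Hölder's inequality for the measure with density `w i` then yields `∑ (∫ |σ| w i)^p ≤ c²
(A B)^(p-1) ‖σ‖_p^p` (`sum_lintegral_rpow_le`). This dominates `∑ |⟨u i, P (e i)⟩|^p`. A bound on
such sums, uniform over finite orthonormal families, forces compactness and bounds the `ℓ^p` norm of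
the singular values, as the polar decomposition shows. One-element families give the operator norm,
the case `p = 1` with `e = u` a basis gives the trace, and the uncertainty inequality combines the
operator norm bounds for `p = 1` and `p = ∞`.

The remaining analysis concerns the cone. Its boundary is a null set, so the kernel is measurable
and bounded almost everywhere. The measure has temperate growth, so Schwartz functions are
integrable and dense in `L²`, and Parseval extends the transform to an isometry `U`. Since `φ f` is
in `L¹ ∩ L²` but is not Schwartz, `U` must agree with the integral on `L¹ ∩ L²`; this follows by
approximating in both norms at once. -/

namespace WaveletMultiplier

/-! ### Compactness and singular values from sums over orthonormal families -/

section SchattenCriterion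

universe u

variable {H : Type u} [NormedAddCommGroup H] [InnerProductSpace ℂ H]

/-- Adjoining a unit vector orthogonal to an orthonormal family. -/
theorem orthonormal_option {ι : Type*} {e : ι → H} (he : Orthonormal ℂ e) {x : H} (hx : ‖x‖ = 1)
    (hxe : ∀ i, ⟪e i, x⟫_ℂ = 0) : Orthonormal ℂ (fun o : Option ι => o.elim x e) := by
  constructor
  · rintro (_ | i)
    · exact hx
    · exact he.1 i
  · rintro (_ | i) (_ | j) hij
    · exact absurd rfl hij
    · simpa using inner_eq_zero_symm.1 (hxe j)
    · simpa using hxe i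
    · exact he.2 fun h => hij (by rw [h])

theorem isCompactOperator_starProjection (W : Submodule ℂ H) [FiniteDimensional ℂ W] :
    IsCompactOperator W.starProjection := by
  have h : IsCompactOperator (_root_.id : W → W) :=
    isCompactOperator_id_iff_finiteDimensional (𝕜 := ℂ).2 inferInstance
  exact (h.comp_clm W.orthogonalProjectionOnto).clm_comp W.subtypeL

/-- If all finite-dimensional corners of `A` have norm above `ε`, there are arbitrarily long
orthonormal families `e`, `u` with `ε ≤ |⟨u i, A (e i)⟩|`. -/
theorem exists_orthonormal_of_corner_norm_gt (A : H →L[ℂ] H) {ε : ℝ} (hε : 0 < ε)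
    (h : ∀ (V W : Submodule ℂ H) [FiniteDimensional ℂ V] [FiniteDimensional ℂ W],
      ε < ‖Wᗮ.starProjection ∘L A ∘L Vᗮ.starProjection‖) (n : ℕ) :
    ∃ (ι : Type) (_ : Fintype ι) (e u : ι → H), Fintype.card ι = n ∧ Orthonormal ℂ e ∧
      Orthonormal ℂ u ∧ ∀ i, ε ≤ ‖⟪u i, A (e i)⟫_ℂ‖ := by
  induction n with
  | zero =>
    exact ⟨Empty, inferInstance, Empty.elim, Empty.elim, rfl, by simp [Orthonormal],
      by simp [Orthonormal], by simp⟩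
  | succ n ih =>
    obtain ⟨ι, _, e, u, hn, he, hu, hA⟩ := ih
    have : FiniteDimensional ℂ (Submodule.span ℂ (range e)) :=
      FiniteDimensional.span_of_finite ℂ (finite_range e)
    have : FiniteDimensional ℂ (Submodule.span ℂ (range u)) :=
      FiniteDimensional.span_of_finite ℂ (finite_range u)
    set V := Submodule.span ℂ (range e)
    set W := Submodule.span ℂ (range u)
    -- The new vectors are `y / ‖y‖` and `z / ‖z‖`. Since `z` is the projection of `A y`, `⟨z, A y⟩
    -- = ‖z‖²`, so the new coefficient is `‖z‖ / ‖y‖`, which exceeds `ε` because `‖y‖ ≤ ‖x‖`.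
    obtain ⟨x, hx⟩ : ∃ x, ε * ‖x‖ < ‖Wᗮ.starProjection (A (Vᗮ.starProjection x))‖ := by
      by_contra! hc
      exact (h V W).not_ge (ContinuousLinearMap.opNorm_le_bound _ hε.le hc)
    set y := Vᗮ.starProjection x with hy
    set z := Wᗮ.starProjection (A y) with hz
    have hyV : y ∈ Vᗮ := Submodule.starProjection_apply_mem _ _
    have hzW : z ∈ Wᗮ := Submodule.starProjection_apply_mem _ _
    have hz0 : 0 < ‖z‖ := (by positivity : 0 ≤ ε * ‖x‖).trans_lt hx
    have hy0 : 0 < ‖y‖ := by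
      rw [norm_pos_iff]
      rintro h0
      rw [hz, h0] at hz0
      simp at hz0
    have hyx : ‖y‖ ≤ ‖x‖ := Submodule.norm_starProjection_apply_le _ _
    have hzA : ⟪z, A y⟫_ℂ = (‖z‖ : ℂ) ^ 2 := by
      have h1 : ⟪z, z⟫_ℂ = ⟪z, A y⟫_ℂ := by
        conv_lhs => rw [hz, ← Submodule.inner_starProjection_left_eq_right,
          Submodule.starProjection_eq_self_iff.2 hzW]
      rw [← h1, inner_self_eq_norm_sq_to_K]
      rfl
    refine ⟨Option ι, inferInstance, fun o => o.elim ((‖y‖⁻¹ : ℂ) • y) e,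
      fun o => o.elim ((‖z‖⁻¹ : ℂ) • z) u, by simp [hn], orthonormal_option he ?_ ?_,
      orthonormal_option hu ?_ ?_, ?_⟩
    · simp [norm_smul, hy0.ne']
    · intro i
      rw [inner_smul_right, Submodule.inner_right_of_mem_orthogonal
        (Submodule.subset_span (mem_range_self i)) hyV, mul_zero]
    · simp [norm_smul, hz0.ne']
    · intro i
      rw [inner_smul_right, Submodule.inner_right_of_mem_orthogonal
        (Submodule.subset_span (mem_range_self i)) hzW, mul_zero]
    · rintro (_ | i)
      · simp only [Option.elim, map_smul, inner_smul_left, inner_smul_right, hzA]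
        simp only [map_inv₀, Complex.conj_ofReal, norm_mul, norm_inv, Complex.norm_real, norm_norm,
          norm_pow]
        have : ‖y‖⁻¹ * (‖z‖⁻¹ * ‖z‖ ^ 2) = ‖z‖ / ‖y‖ := by field_simp
        rw [this, le_div_iff₀ hy0]
        exact (mul_le_mul_of_nonneg_left hyx hε.le).trans hx.le
      · exact hA i

variable [CompleteSpace H]

/-- If every corner `W^⊥ A V^⊥` stayed above a fixed size, arbitrarily long families with
coefficients bounded below would break the bound `C`. So some corner is small, and `A` minus that
corner has finite rank; hence `A` is a norm limit of compact operators. -/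
theorem isCompactOperator_of_sum_inner_rpow_le (A : H →L[ℂ] H) {p C : ℝ} (hp : 0 < p)
    (h : ∀ (ι : Type) [Fintype ι] (e u : ι → H), Orthonormal ℂ e → Orthonormal ℂ u →
      ∑ i, ‖⟪u i, A (e i)⟫_ℂ‖ ^ p ≤ C) : IsCompactOperator A := by
  have hclosed : IsClosed {f : H →L[ℂ] H | IsCompactOperator f} :=
    isClosed_setOfPred_isCompactOperator
  refine hclosed.closure_subset (Metric.mem_closure_iff.2 fun ε hε => ?_)
  obtain ⟨V, W, hV, hW, hVW⟩ : ∃ (V W : Submodule ℂ H) (_ : FiniteDimensional ℂ V)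
      (_ : FiniteDimensional ℂ W), ‖Wᗮ.starProjection ∘L A ∘L Vᗮ.starProjection‖ ≤ ε / 2 := by
    by_contra! hc
    obtain ⟨n, hn⟩ := exists_nat_gt (C / (ε / 2) ^ p)
    obtain ⟨ι, _, e, u, hι, he, hu, hA⟩ := exists_orthonormal_of_corner_norm_gt A (half_pos hε)
      (fun V W hV hW => hc V W hV hW) n
    have h1 : ∑ _i : ι, (ε / 2) ^ p ≤ C := (Finset.sum_le_sum fun i _ =>
      Real.rpow_le_rpow (half_pos hε).le (hA i) hp.le).trans (h ι e u he hu)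
    rw [Finset.sum_const, Finset.card_univ, hι, nsmul_eq_mul] at h1
    rw [div_lt_iff₀ (by positivity)] at hn
    exact hn.not_ge h1
  refine ⟨A - Wᗮ.starProjection ∘L A ∘L Vᗮ.starProjection, ?_, ?_⟩
  · have : A - Wᗮ.starProjection ∘L A ∘L Vᗮ.starProjection =
        W.starProjection ∘L A + Wᗮ.starProjection ∘L A ∘L V.starProjection := by
      ext x
      simp [Submodule.starProjection_orthogonal']
      abel
    rw [mem_ofPred_eq, this]
    exact ((isCompactOperator_starProjection W).comp_clm A).add
      ((isCompactOperator_starProjection V).clm_comp (Wᗮ.starProjection ∘L A))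
  · rw [dist_eq_norm, sub_sub_cancel]
    linarith

/-- The bound is tested on orthonormal eigenvectors `e` of `|A|` and on `u = A e / t`, where `t` is
the eigenvalue. As `⟨A x, A y⟩ = ⟨|A| x, |A| y⟩`, the family `u` is again orthonormal, and `⟨u, A e⟩
= t` recovers the singular value. -/
theorem tsum_finrank_eigenspace_abs_le (A : H →L[ℂ] H) {p C : ℝ} (hp : 0 < p)
    (h : ∀ (ι : Type) [Fintype ι] (e u : ι → H), Orthonormal ℂ e → Orthonormal ℂ u →
      ∑ i, ‖⟪u i, A (e i)⟫_ℂ‖ ^ p ≤ C) :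
    ∑' t : ℝ≥0, (Module.finrank ℂ (Module.End.eigenspace
      ((CFC.abs A : H →L[ℂ] H) : H →ₗ[ℂ] H) ((t : ℝ) : ℂ)) : ℝ≥0∞) * (t : ℝ≥0∞) ^ p ≤
      ENNReal.ofReal C := by
  set B : H →L[ℂ] H := CFC.abs A with hB
  have hBsa : IsSelfAdjoint B := (CFC.abs_nonneg A).isSelfAdjoint
  have hBsym : (B : H →ₗ[ℂ] H).IsSymmetric := hBsa.isSymmetric
  have hBA : ∀ x y, ⟪A x, A y⟫_ℂ = ⟪B x, B y⟫_ℂ := by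
    intro x y
    have h1 : B * B = star A * A := CFC.abs_mul_abs A
    calc ⟪A x, A y⟫_ℂ = ⟪x, (star A * A) y⟫_ℂ := by
          rw [ContinuousLinearMap.star_eq_adjoint, mul_apply_eq_comp,
            ContinuousLinearMap.adjoint_inner_right]
      _ = ⟪B x, B y⟫_ℂ := by
          rw [← h1, mul_apply_eq_comp]
          exact (hBsym x (B y)).symm
  classical
  rw [ENNReal.tsum_eq_iSup_sum]
  refine iSup_le fun S => ?_
  let E : ℝ≥0 → Submodule ℂ H := fun t => Module.End.eigenspace (B : H →ₗ[ℂ] H) ((t : ℝ) : ℂ)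
  -- Nothing is lost from the sum: `0 ^ p = 0`, and `finrank` takes the default value `0` on an
  -- infinite-dimensional eigenspace.
  let S' := S.filter fun t => t ≠ 0 ∧ FiniteDimensional ℂ (E t)
  have hS : ∑ t ∈ S, (Module.finrank ℂ (E t) : ℝ≥0∞) * (t : ℝ≥0∞) ^ p =
      ∑ t ∈ S', (Module.finrank ℂ (E t) : ℝ≥0∞) * (t : ℝ≥0∞) ^ p := by
    refine (Finset.sum_filter_of_ne fun t _ ht => ⟨?_, ?_⟩).symm
    · rintro rfl
      simp [hp] at ht
    · by_contra hf
      exact ht (by simp [Module.finrank_of_not_finite hf])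
  have hfin : ∀ t : S', FiniteDimensional ℂ (E t) := fun t => (Finset.mem_filter.1 t.2).2.2
  have hne : ∀ t : S', (t : ℝ≥0) ≠ 0 := fun t => (Finset.mem_filter.1 t.2).2.1
  let ι := Σ t : S', Fin (Module.finrank ℂ (E t))
  let e : ι → H := fun i => (stdOrthonormalBasis ℂ (E i.1) i.2 : E i.1)
  have he : Orthonormal ℂ e := by
    have h0 := hBsym.orthogonalFamily_eigenspaces.comp (γ := S')
      (f := fun t => (((t : ℝ≥0) : ℝ) : ℂ)) (fun a b hab =>
        Subtype.ext (NNReal.coe_injective (Complex.ofReal_injective hab)))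
    exact h0.orthonormal_sigma_orthonormal fun t => (stdOrthonormalBasis ℂ (E t)).orthonormal
  have hBe : ∀ i : ι, B (e i) = (((i.1 : ℝ≥0) : ℝ) : ℂ) • e i := fun i =>
    Module.End.mem_eigenspace_iff.1 (stdOrthonormalBasis ℂ (E i.1) i.2 : E i.1).2
  have ht : ∀ i : ι, (((i.1 : ℝ≥0) : ℝ) : ℂ) ≠ 0 := fun i =>
    Complex.ofReal_ne_zero.2 (NNReal.coe_ne_zero.2 (hne i.1))
  have hAe : ∀ i j : ι, ⟪A (e i), A (e j)⟫_ℂ =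
      (((i.1 : ℝ≥0) : ℝ) : ℂ) * (((j.1 : ℝ≥0) : ℝ) : ℂ) * ⟪e i, e j⟫_ℂ := by
    intro i j
    rw [hBA, hBe, hBe, inner_smul_left, inner_smul_right, Complex.conj_ofReal, mul_assoc]
  let u : ι → H := fun i => (((i.1 : ℝ≥0) : ℝ) : ℂ)⁻¹ • A (e i)
  have hu : Orthonormal ℂ u := by
    rw [orthonormal_iff_ite] at he ⊢
    intro i j
    simp only [u, inner_smul_left, inner_smul_right, hAe, he]
    split_ifs with hij
    · subst hij
      have := ht i
      simp only [map_inv₀, Complex.conj_ofReal]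
      field_simp
    · simp
  have huA : ∀ i : ι, ‖⟪u i, A (e i)⟫_ℂ‖ = ((i.1 : ℝ≥0) : ℝ) := by
    intro i
    have hi := ht i
    have : ⟪u i, A (e i)⟫_ℂ = (((i.1 : ℝ≥0) : ℝ) : ℂ) := by
      simp only [u, inner_smul_left, hAe, inner_self_eq_norm_sq_to_K, he.1 i, map_inv₀,
        Complex.conj_ofReal]
      field_simp
      simp
    rw [this]
    simp
  have key := h ι e u he hu
  rw [hS]
  calc ∑ t ∈ S', (Module.finrank ℂ (E t) : ℝ≥0∞) * (t : ℝ≥0∞) ^ p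
      = ∑ t : S', (Module.finrank ℂ (E t) : ℝ≥0∞) * ((t : ℝ≥0) : ℝ≥0∞) ^ p :=
        (Finset.sum_coe_sort S' fun t => (Module.finrank ℂ (E t) : ℝ≥0∞) * (t : ℝ≥0∞) ^ p).symm
    _ = ∑ i : ι, ((i.1 : ℝ≥0) : ℝ≥0∞) ^ p := by
        rw [Fintype.sum_sigma]
        simp
    _ = ENNReal.ofReal (∑ i, ‖⟪u i, A (e i)⟫_ℂ‖ ^ p) := by
        rw [ENNReal.ofReal_sum_of_nonneg fun i _ => by positivity]
        refine Finset.sum_congr rfl fun i _ => ?_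
        rw [huA, ← ENNReal.ofReal_rpow_of_nonneg (by positivity) hp.le, ENNReal.ofReal_coe_nnreal]
    _ ≤ ENNReal.ofReal C := ENNReal.ofReal_le_ofReal key

end SchattenCriterion

/-! ### Multipliers built from bounded sampling families -/

section Sampling

universe u

variable {X : Type*} [MeasurableSpace X] {μ : Measure X}
variable {H : Type u} [NormedAddCommGroup H] [InnerProductSpace ℂ H]

/-- A family of functions `F f` on `X`, `f ∈ H`, whose values at almost every point are given by
a vector of norm at most `c`, and which is bounded from `H` to `L²(μ)` with constant `A`. -/
structure BoundedSampling (μ : Measure X) (F : H → X → ℂ) (c A : ℝ≥0∞) : Prop where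
  ae_repr : ∀ᵐ ξ ∂μ, ∃ k : H, ‖k‖ₑ ≤ c ∧ ∀ f, F f ξ = ⟪k, f⟫_ℂ
  aestronglyMeasurable : ∀ f, AEStronglyMeasurable (F f) μ
  eLpNorm_le : ∀ f, eLpNorm (F f) 2 μ ≤ A * ‖f‖ₑ

/-- Cauchy–Schwarz for the sum, then Bessel's inequality for each factor. -/
theorem sum_enorm_inner_mul_enorm_inner_le {ι : Type*} [Fintype ι] {e u : ι → H}
    (he : Orthonormal ℂ e) (hu : Orthonormal ℂ u) (k l : H) :
    ∑ i, ‖⟪k, e i⟫_ℂ‖ₑ * ‖⟪l, u i⟫_ℂ‖ₑ ≤ ‖k‖ₑ * ‖l‖ₑ := by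
  have h1 : ∑ i, ‖⟪k, e i⟫_ℂ‖ * ‖⟪l, u i⟫_ℂ‖ ≤ ‖k‖ * ‖l‖ := by
    refine (Real.sum_mul_le_sqrt_mul_sqrt _ _ _).trans ?_
    gcongr
    · refine Real.sqrt_le_iff.2 ⟨norm_nonneg _, ?_⟩
      simpa only [norm_inner_symm k] using he.sum_inner_products_le k (s := Finset.univ)
    · refine Real.sqrt_le_iff.2 ⟨norm_nonneg _, ?_⟩
      simpa only [norm_inner_symm l] using hu.sum_inner_products_le l (s := Finset.univ)
  have h2 := ENNReal.ofReal_le_ofReal h1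
  rw [ENNReal.ofReal_sum_of_nonneg fun i _ => by positivity] at h2
  simpa only [ENNReal.ofReal_mul (norm_nonneg _), ofReal_norm] using h2

/-- Hölder's inequality for an integral with weight `w`. -/
theorem lintegral_mul_rpow_le {s w : X → ℝ≥0∞} (hs : AEMeasurable s μ) (hw : AEMeasurable w μ)
    (hw_top : ∀ᵐ x ∂μ, w x ≠ ∞) {p : ℝ} (hp : 1 ≤ p) :
    (∫⁻ x, s x * w x ∂μ) ^ p ≤ (∫⁻ x, s x ^ p * w x ∂μ) * (∫⁻ x, w x ∂μ) ^ (p - 1) := by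
  have hp0 : 0 < p := by linarith
  have h0 : 0 ≤ 1 - p⁻¹ := sub_nonneg.2 (inv_le_one_of_one_le₀ hp)
  have h := ENNReal.lintegral_mul_norm_pow_le ((hs.pow_const p).mul hw) hw
    (inv_nonneg.2 hp0.le) h0 (by ring)
  -- The splitting `s w = (s^p w)^(1/p) w^(1 - 1/p)` sets up Hölder with conjugate exponents.
  have heq : ∫⁻ x, s x * w x ∂μ = ∫⁻ x, (s x ^ p * w x) ^ p⁻¹ * w x ^ (1 - p⁻¹) ∂μ := by
    refine lintegral_congr_ae ?_
    filter_upwards [hw_top] with x hx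
    rw [ENNReal.mul_rpow_of_nonneg _ _ (inv_nonneg.2 hp0.le), ← ENNReal.rpow_mul,
      mul_inv_cancel₀ hp0.ne', ENNReal.rpow_one, mul_assoc,
      ← ENNReal.rpow_add_of_nonneg _ _ (inv_nonneg.2 hp0.le) h0]
    simp
  rw [heq]
  refine (ENNReal.rpow_le_rpow h hp0.le).trans_eq ?_
  simp only [Pi.mul_apply]
  rw [ENNReal.mul_rpow_of_nonneg _ _ hp0.le, ← ENNReal.rpow_mul, ← ENNReal.rpow_mul,
    inv_mul_cancel₀ hp0.ne', ENNReal.rpow_one, sub_mul, inv_mul_cancel₀ hp0.ne', one_mul]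

namespace BoundedSampling

variable {F G : H → X → ℂ} {c A B : ℝ≥0∞}

theorem lintegral_enorm_mul_le (hF : BoundedSampling μ F c A) (hG : BoundedSampling μ G c B)
    (f g : H) : ∫⁻ ξ, ‖F f ξ‖ₑ * ‖G g ξ‖ₑ ∂μ ≤ A * B * (‖f‖ₑ * ‖g‖ₑ) := by
  have h := ENNReal.lintegral_mul_le_Lp_mul_Lq μ Real.HolderConjugate.two_two
    (hF.aestronglyMeasurable f).enorm (hG.aestronglyMeasurable g).enorm
  have h1 := hF.eLpNorm_le f
  have h2 := hG.eLpNorm_le g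
  rw [eLpNorm_eq_lintegral_rpow_enorm_toReal two_ne_zero ENNReal.ofNat_ne_top] at h1 h2
  simp only [ENNReal.toReal_ofNat] at h1 h2
  calc _ ≤ _ := h
    _ ≤ (A * ‖f‖ₑ) * (B * ‖g‖ₑ) := mul_le_mul' h1 h2
    _ = _ := by ring

variable {σ : X → ℂ} {p : ℝ≥0∞}

/-- The key estimate, over all pairs of orthonormal families. -/
theorem sum_lintegral_rpow_le (hF : BoundedSampling μ F c A) (hG : BoundedSampling μ G c B)
    (hc : c ≠ ∞) (hσ : AEStronglyMeasurable σ μ) (hp : 1 ≤ p) (hp' : p ≠ ∞)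
    {ι : Type*} [Fintype ι] {e u : ι → H} (he : Orthonormal ℂ e) (hu : Orthonormal ℂ u) :
    ∑ i, (∫⁻ ξ, ‖σ ξ‖ₑ * (‖F (e i) ξ‖ₑ * ‖G (u i) ξ‖ₑ) ∂μ) ^ p.toReal ≤
      (c ^ (2 * (p⁻¹).toReal) * (A * B) ^ (1 - (p⁻¹).toReal) * eLpNorm σ p μ) ^ p.toReal := by
  have hp1 : 1 ≤ p.toReal := by
    rw [← ENNReal.toReal_one]
    exact ENNReal.toReal_mono hp' hp
  have hp0 : 0 < p.toReal := by linarith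
  have hw : ∀ i, AEMeasurable (fun ξ => ‖F (e i) ξ‖ₑ * ‖G (u i) ξ‖ₑ) μ := fun i =>
    (hF.aestronglyMeasurable _).enorm.mul (hG.aestronglyMeasurable _).enorm
  have hs : AEMeasurable (fun ξ => ‖σ ξ‖ₑ) μ := hσ.enorm
  have hsum : ∀ᵐ ξ ∂μ, ∑ i, ‖F (e i) ξ‖ₑ * ‖G (u i) ξ‖ₑ ≤ c ^ 2 := by
    filter_upwards [hF.ae_repr, hG.ae_repr] with ξ ⟨k, hk, hFk⟩ ⟨l, hl, hGl⟩
    simp only [hFk, hGl]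
    refine (sum_enorm_inner_mul_enorm_inner_le he hu k l).trans ?_
    rw [sq]
    exact mul_le_mul' hk hl
  have hpow : ∫⁻ ξ, ‖σ ξ‖ₑ ^ p.toReal ∂μ = eLpNorm σ p μ ^ p.toReal := by
    rw [eLpNorm_eq_lintegral_rpow_enorm_toReal (by positivity) hp', one_div, ← ENNReal.rpow_mul,
      inv_mul_cancel₀ hp0.ne', ENNReal.rpow_one]
  -- Hölder with weight `w i` costs its mass, at most `A B`, to the power `p - 1`. Only after that
  -- is the sum taken under the integral, where it is at most `c²`. The right-hand side is `c² (A
  -- B)^(p-1) ‖σ‖_p^p` written as a `p`-th power.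
  calc ∑ i, (∫⁻ ξ, ‖σ ξ‖ₑ * (‖F (e i) ξ‖ₑ * ‖G (u i) ξ‖ₑ) ∂μ) ^ p.toReal
      ≤ ∑ i, (∫⁻ ξ, ‖σ ξ‖ₑ ^ p.toReal * (‖F (e i) ξ‖ₑ * ‖G (u i) ξ‖ₑ) ∂μ) *
          (A * B) ^ (p.toReal - 1) := by
        refine Finset.sum_le_sum fun i _ => ?_
        refine (lintegral_mul_rpow_le hs (hw i) (ae_of_all _ fun ξ =>
          ENNReal.mul_ne_top enorm_ne_top enorm_ne_top) hp1).trans ?_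
        refine mul_le_mul' le_rfl (ENNReal.rpow_le_rpow
          ((hF.lintegral_enorm_mul_le hG _ _).trans_eq ?_) (by linarith))
        rw [← ofReal_norm, ← ofReal_norm, he.1 i, hu.1 i]
        simp
    _ = (∫⁻ ξ, ‖σ ξ‖ₑ ^ p.toReal * ∑ i, ‖F (e i) ξ‖ₑ * ‖G (u i) ξ‖ₑ ∂μ) *
          (A * B) ^ (p.toReal - 1) := by
        simp only [← Finset.sum_mul, Finset.mul_sum]
        congr 1
        exact (lintegral_finsetSum' _ fun i _ => (hs.pow_const _).mul (hw i)).symm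
    _ ≤ (∫⁻ ξ, ‖σ ξ‖ₑ ^ p.toReal * c ^ 2 ∂μ) * (A * B) ^ (p.toReal - 1) := by
        gcongr ?_ * _
        refine lintegral_mono_ae ?_
        filter_upwards [hsum] with ξ hξ
        gcongr
    _ = _ := by
        rw [lintegral_mul_const' _ _ (ENNReal.pow_ne_top hc), hpow,
          ENNReal.mul_rpow_of_nonneg _ _ hp0.le, ENNReal.mul_rpow_of_nonneg _ _ hp0.le,
          ← ENNReal.rpow_mul, ← ENNReal.rpow_mul, ENNReal.toReal_inv, sub_mul, mul_assoc 2,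
          inv_mul_cancel₀ hp0.ne', one_mul, mul_one, ENNReal.rpow_two]
        ring

/-- For `p = ∞`, pull out the essential supremum of `σ` and apply Cauchy–Schwarz. For `p < ∞`, apply
the estimate for orthonormal families to the single vectors `f / ‖f‖` and `g / ‖g‖`, and rescale. -/
theorem lintegral_le (hF : BoundedSampling μ F c A) (hG : BoundedSampling μ G c B)
    (hc : c ≠ ∞) (hσ : AEStronglyMeasurable σ μ) (hp : 1 ≤ p) (f g : H) :
    ∫⁻ ξ, ‖σ ξ‖ₑ * (‖F f ξ‖ₑ * ‖G g ξ‖ₑ) ∂μ ≤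
      c ^ (2 * (p⁻¹).toReal) * (A * B) ^ (1 - (p⁻¹).toReal) * eLpNorm σ p μ * (‖f‖ₑ * ‖g‖ₑ) := by
  rcases eq_or_ne p ∞ with rfl | hp'
  · simp only [ENNReal.inv_top, ENNReal.toReal_zero, mul_zero, ENNReal.rpow_zero, one_mul, sub_zero,
      ENNReal.rpow_one, eLpNorm_exponent_top]
    calc ∫⁻ ξ, ‖σ ξ‖ₑ * (‖F f ξ‖ₑ * ‖G g ξ‖ₑ) ∂μ
        ≤ ∫⁻ ξ, eLpNormEssSup σ μ * (‖F f ξ‖ₑ * ‖G g ξ‖ₑ) ∂μ := by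
          refine lintegral_mono_ae ?_
          filter_upwards [enorm_ae_le_eLpNormEssSup σ μ] with ξ hξ
          gcongr
      _ = eLpNormEssSup σ μ * ∫⁻ ξ, ‖F f ξ‖ₑ * ‖G g ξ‖ₑ ∂μ :=
          lintegral_const_mul'' _
            ((hF.aestronglyMeasurable _).enorm.mul (hG.aestronglyMeasurable _).enorm)
      _ ≤ eLpNormEssSup σ μ * (A * B * (‖f‖ₑ * ‖g‖ₑ)) := by
          gcongr
          exact hF.lintegral_enorm_mul_le hG f g
      _ = _ := by ring
  rcases eq_or_ne f 0 with rfl | hf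
  · refine (lintegral_eq_zero_of_ae_eq_zero ?_).trans_le zero_le
    filter_upwards [hF.ae_repr] with ξ ⟨k, _, hk⟩
    simp [hk]
  rcases eq_or_ne g 0 with rfl | hg
  · refine (lintegral_eq_zero_of_ae_eq_zero ?_).trans_le zero_le
    filter_upwards [hG.ae_repr] with ξ ⟨k, _, hk⟩
    simp [hk]
  have hp0 : 0 < p.toReal := ENNReal.toReal_pos (by positivity) hp'
  have horth : ∀ {x : H}, x ≠ 0 → Orthonormal ℂ fun _ : Unit => ((‖x‖⁻¹ : ℝ) : ℂ) • x := by
    intro x hx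
    refine ⟨fun _ => ?_, fun i j hij => absurd (Subsingleton.elim i j) hij⟩
    simp [norm_smul, hx]
  have h := hF.sum_lintegral_rpow_le hG hc hσ hp hp' (horth hf) (horth hg)
  rw [Fintype.sum_unique, ENNReal.rpow_le_rpow_iff hp0] at h
  refine le_trans (le_of_eq ?_) (mul_le_mul_left h (‖f‖ₑ * ‖g‖ₑ))
  rw [← lintegral_mul_const' _ _ (ENNReal.mul_ne_top enorm_ne_top enorm_ne_top)]
  refine lintegral_congr_ae ?_
  filter_upwards [hF.ae_repr, hG.ae_repr] with ξ ⟨k, _, hk⟩ ⟨l, _, hl⟩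
  have hcancel : ∀ {x : H}, x ≠ 0 → ‖x‖ₑ * ‖((‖x‖⁻¹ : ℝ) : ℂ)‖ₑ = 1 := by
    intro x hx
    rw [← ofReal_norm, ← ofReal_norm, ← ENNReal.ofReal_mul (norm_nonneg _)]
    simp [hx]
  simp only [hk, hl, inner_smul_right, enorm_mul]
  calc ‖σ ξ‖ₑ * (‖⟪k, f⟫_ℂ‖ₑ * ‖⟪l, g⟫_ℂ‖ₑ)
      = ‖σ ξ‖ₑ * (1 * ‖⟪k, f⟫_ℂ‖ₑ * (1 * ‖⟪l, g⟫_ℂ‖ₑ)) := by simp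
    _ = _ := by
        nth_rw 1 [← hcancel hf]
        rw [← hcancel hg]
        ring

end BoundedSampling

/-- `P` is the operator `⟨P f, g⟩ = ∫ σ (F f) conj (G g)`. -/
def IsSamplingMultiplier (μ : Measure X) (F G : H → X → ℂ) (σ : X → ℂ) (P : H →L[ℂ] H) : Prop :=
  ∀ f g : H, Integrable (fun ξ => σ ξ * F f ξ * conj (G g ξ)) μ ∧
    ⟪g, P f⟫_ℂ = ∫ ξ, σ ξ * F f ξ * conj (G g ξ) ∂μ

theorem IsSamplingMultiplier.unique {F G : H → X → ℂ} {σ : X → ℂ} {P P' : H →L[ℂ] H}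
    (hP : IsSamplingMultiplier μ F G σ P) (hP' : IsSamplingMultiplier μ F G σ P') : P = P' := by
  ext f
  exact ext_inner_left ℂ fun g => (hP f g).2.trans (hP' f g).2.symm

theorem enorm_mul_mul_conj (a b c : ℂ) : ‖a * b * conj c‖ₑ = ‖a‖ₑ * (‖b‖ₑ * ‖c‖ₑ) := by
  rw [enorm_mul, enorm_mul, mul_assoc, ← ofReal_norm (conj c), RCLike.norm_conj, ofReal_norm]

theorem IsSamplingMultiplier.enorm_inner_le {F G : H → X → ℂ} {σ : X → ℂ} {P : H →L[ℂ] H}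
    (hP : IsSamplingMultiplier μ F G σ P) (f g : H) :
    ‖⟪g, P f⟫_ℂ‖ₑ ≤ ∫⁻ ξ, ‖σ ξ‖ₑ * (‖F f ξ‖ₑ * ‖G g ξ‖ₑ) ∂μ := by
  rw [(hP f g).2]
  refine (enorm_integral_le_lintegral_enorm _).trans_eq ?_
  simp only [enorm_mul_mul_conj]

namespace BoundedSampling

variable {F G : H → X → ℂ} {c A B : ℝ≥0∞} {σ : X → ℂ} {p : ℝ≥0∞}

theorem bound_ne_top (hc : c ≠ ∞) (hA : A ≠ ∞) (hB : B ≠ ∞) (hσ : MemLp σ p μ) (hp : 1 ≤ p) :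
    c ^ (2 * (p⁻¹).toReal) * (A * B) ^ (1 - (p⁻¹).toReal) * eLpNorm σ p μ ≠ ∞ := by
  have h1 : (p⁻¹).toReal ≤ 1 := by
    rw [← ENNReal.toReal_one]
    exact ENNReal.toReal_mono ENNReal.one_ne_top (ENNReal.inv_le_one.2 hp)
  exact ENNReal.mul_ne_top (ENNReal.mul_ne_top (ENNReal.rpow_ne_top_of_nonneg (by positivity) hc)
    (ENNReal.rpow_ne_top_of_nonneg (by linarith) (ENNReal.mul_ne_top hA hB))) hσ.2.ne

theorem integrable (hF : BoundedSampling μ F c A) (hG : BoundedSampling μ G c B)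
    (hc : c ≠ ∞) (hA : A ≠ ∞) (hB : B ≠ ∞) (hσ : MemLp σ p μ) (hp : 1 ≤ p) (f g : H) :
    Integrable (fun ξ => σ ξ * F f ξ * conj (G g ξ)) μ := by
  refine ⟨(hσ.1.mul (hF.aestronglyMeasurable f)).mul
    (Complex.continuous_conj.comp_aestronglyMeasurable (hG.aestronglyMeasurable g)), ?_⟩
  rw [hasFiniteIntegral_iff_enorm]
  simp only [enorm_mul_mul_conj]
  exact (hF.lintegral_le hG hc hσ.1 hp f g).trans_lt (ENNReal.mul_lt_top
    (bound_ne_top hc hA hB hσ hp).lt_top (ENNReal.mul_lt_top enorm_lt_top enorm_lt_top))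

theorem enorm_le (hF : BoundedSampling μ F c A) (hG : BoundedSampling μ G c B)
    (hc : c ≠ ∞) (hA : A ≠ ∞) (hB : B ≠ ∞) (hσ : MemLp σ p μ) (hp : 1 ≤ p)
    {P : H →L[ℂ] H} (hP : IsSamplingMultiplier μ F G σ P) :
    ‖P‖ₑ ≤ c ^ (2 * (p⁻¹).toReal) * (A * B) ^ (1 - (p⁻¹).toReal) * eLpNorm σ p μ := by
  have hD := bound_ne_top hc hA hB hσ hp
  set D := c ^ (2 * (p⁻¹).toReal) * (A * B) ^ (1 - (p⁻¹).toReal) * eLpNorm σ p μ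
  rw [← ofReal_norm]
  refine ENNReal.ofReal_le_of_le_toReal (P.opNorm_le_bound ENNReal.toReal_nonneg fun f => ?_)
  -- Testing against `g = P f` gives `‖P f‖² ≤ D ‖f‖ ‖P f‖`.
  have h1 : ‖⟪P f, P f⟫_ℂ‖ₑ ≤ D * (‖f‖ₑ * ‖P f‖ₑ) :=
    (hP.enorm_inner_le f (P f)).trans (hF.lintegral_le hG hc hσ.1 hp f (P f))
  clear_value D
  have h2 := ENNReal.toReal_mono
    (ENNReal.mul_ne_top hD (ENNReal.mul_ne_top enorm_ne_top enorm_ne_top)) h1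
  rw [toReal_enorm, inner_self_eq_norm_sq_to_K, norm_pow, ENNReal.toReal_mul,
    ENNReal.toReal_mul, toReal_enorm, toReal_enorm, RCLike.norm_ofReal, abs_norm, sq,
    ← mul_assoc] at h2
  rcases (norm_nonneg (P f)).eq_or_lt with h0 | h0
  · rw [← h0]
    positivity
  · exact le_of_mul_le_mul_right h2 h0

variable [CompleteSpace H]

theorem exists_isSamplingMultiplier (hF : BoundedSampling μ F c A) (hG : BoundedSampling μ G c B)
    (hc : c ≠ ∞) (hA : A ≠ ∞) (hB : B ≠ ∞) (hσ : MemLp σ p μ) (hp : 1 ≤ p) :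
    ∃ P : H →L[ℂ] H, IsSamplingMultiplier μ F G σ P := by
  have hint := hF.integrable hG hc hA hB hσ hp
  -- The outer conjugate makes the form antilinear in `f` and linear in `g`, the shape of `⟨P f, g⟩`
  -- in the convention where the inner product is linear in its second argument. The Riesz
  -- representation then provides `P`.
  let S : H →ₗ⋆[ℂ] H →ₗ[ℂ] ℂ := LinearMap.mk₂'ₛₗ (starRingEnd ℂ) (RingHom.id ℂ)
    (fun f g => conj (∫ ξ, σ ξ * F f ξ * conj (G g ξ) ∂μ))
    (fun f f' g => by
      rw [← map_add, ← integral_add (hint f g) (hint f' g)]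
      congr 1
      refine integral_congr_ae ?_
      filter_upwards [hF.ae_repr] with ξ ⟨k, _, hk⟩
      simp only [hk, inner_add_right]
      ring)
    (fun a f g => by
      rw [smul_eq_mul, ← map_mul, ← integral_const_mul]
      congr 1
      refine integral_congr_ae ?_
      filter_upwards [hF.ae_repr] with ξ ⟨k, _, hk⟩
      simp only [hk, inner_smul_right]
      ring)
    (fun f g g' => by
      rw [← map_add, ← integral_add (hint f g) (hint f g')]
      congr 1
      refine integral_congr_ae ?_
      filter_upwards [hG.ae_repr] with ξ ⟨k, _, hk⟩
      simp only [hk, inner_add_right, map_add]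
      ring)
    (fun a f g => by
      rw [RingHom.id_apply, smul_eq_mul, ← Complex.conj_conj a, ← map_mul, ← integral_const_mul]
      congr 1
      refine integral_congr_ae ?_
      filter_upwards [hG.ae_repr] with ξ ⟨k, _, hk⟩
      simp only [hk, inner_smul_right, map_mul, Complex.conj_conj]
      ring)
  set D := c ^ (2 * (p⁻¹).toReal) * (A * B) ^ (1 - (p⁻¹).toReal) * eLpNorm σ p μ
  have hD : D ≠ ∞ := bound_ne_top hc hA hB hσ hp
  have hS : ∀ f g, ‖S f g‖ ≤ D.toReal * ‖f‖ * ‖g‖ := by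
    intro f g
    have h1 : ‖S f g‖ₑ ≤ D * (‖f‖ₑ * ‖g‖ₑ) := by
      rw [← ofReal_norm, show S f g = conj (∫ ξ, σ ξ * F f ξ * conj (G g ξ) ∂μ) from rfl,
        RCLike.norm_conj, ofReal_norm]
      refine (enorm_integral_le_lintegral_enorm _).trans ?_
      simp only [enorm_mul_mul_conj]
      exact hF.lintegral_le hG hc hσ.1 hp f g
    have h2 := ENNReal.toReal_mono
      (ENNReal.mul_ne_top hD (ENNReal.mul_ne_top enorm_ne_top enorm_ne_top)) h1
    simpa [ENNReal.toReal_mul, mul_assoc] using h2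
  refine ⟨InnerProductSpace.continuousLinearMapOfBilin (S.mkContinuous₂ D.toReal hS), fun f g =>
    ⟨hint f g, ?_⟩⟩
  rw [← inner_conj_symm, InnerProductSpace.continuousLinearMapOfBilin_apply]
  exact Complex.conj_conj _

theorem memSchatten_and_schattenNorm_le (hF : BoundedSampling μ F c A)
    (hG : BoundedSampling μ G c B)
    (hc : c ≠ ∞) (hA : A ≠ ∞) (hB : B ≠ ∞) (hσ : MemLp σ p μ) (hp : 1 ≤ p)
    {P : H →L[ℂ] H} (hP : IsSamplingMultiplier μ F G σ P) :
    MemSchatten p P ∧ schattenNorm p P ≤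
      c ^ (2 * (p⁻¹).toReal) * (A * B) ^ (1 - (p⁻¹).toReal) * eLpNorm σ p μ := by
  have hD := bound_ne_top hc hA hB hσ hp
  rcases eq_or_ne p ∞ with rfl | hp'
  · refine ⟨Or.inl rfl, ?_⟩
    rw [schattenNorm, if_pos rfl]
    exact hF.enorm_le hG hc hA hB hσ hp hP
  have hp0 : 0 < p.toReal := ENNReal.toReal_pos (by positivity) hp'
  have hsum : ∀ (ι : Type) [Fintype ι] (e u : ι → H), Orthonormal ℂ e → Orthonormal ℂ u →
      ∑ i, ‖⟪u i, P (e i)⟫_ℂ‖ ^ p.toReal ≤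
        ((c ^ (2 * (p⁻¹).toReal) * (A * B) ^ (1 - (p⁻¹).toReal) *
          eLpNorm σ p μ) ^ p.toReal).toReal := by
    intro ι _ e u he hu
    refine (ENNReal.ofReal_le_iff_le_toReal (ENNReal.rpow_ne_top_of_nonneg hp0.le hD)).1 ?_
    refine le_trans ?_ (hF.sum_lintegral_rpow_le hG hc hσ.1 hp hp' he hu)
    rw [ENNReal.ofReal_sum_of_nonneg fun i _ => by positivity]
    refine Finset.sum_le_sum fun i _ => ?_
    rw [← ENNReal.ofReal_rpow_of_nonneg (norm_nonneg _) hp0.le, ofReal_norm]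
    exact ENNReal.rpow_le_rpow (hP.enorm_inner_le _ _) hp0.le
  have hle : schattenNorm p P ≤
      c ^ (2 * (p⁻¹).toReal) * (A * B) ^ (1 - (p⁻¹).toReal) * eLpNorm σ p μ := by
    have h := tsum_finrank_eigenspace_abs_le P hp0 hsum
    rw [ENNReal.ofReal_toReal (ENNReal.rpow_ne_top_of_nonneg hp0.le hD)] at h
    rw [schattenNorm, if_neg hp']
    exact (ENNReal.rpow_inv_le_iff hp0).2 h
  exact ⟨Or.inr ⟨isCompactOperator_of_sum_inner_rpow_le P hp0 hsum, hle.trans_lt hD.lt_top⟩, hle⟩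

end BoundedSampling

/-! ### The trace formula -/

section Trace

theorem countable_of_orthonormal [TopologicalSpace.SeparableSpace H] {ι : Type*} {e : ι → H}
    (he : Orthonormal ℂ e) : Countable ι := by
  have h : (univ : Set ι).PairwiseDisjoint fun i => Metric.ball (e i) (1 / 2) := by
    intro i _ j _ hij
    refine Metric.ball_disjoint_ball ?_
    -- Hence distinct members are at distance at least `1`, and the balls of radius `1/2` are
    -- disjoint.
    have h1 : ⟪e i, e i - e j⟫_ℂ = 1 := by
      rw [inner_sub_right, he.2 hij, inner_self_eq_norm_sq_to_K, he.1 i]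
      simp
    have h2 := norm_inner_le_norm (𝕜 := ℂ) (e i) (e i - e j)
    rw [h1, he.1 i, norm_one, one_mul, ← dist_eq_norm] at h2
    linarith
  rw [← countable_univ_iff]
  exact h.countable_of_isOpen (fun i _ => Metric.isOpen_ball)
    fun i _ => ⟨e i, Metric.mem_ball_self (by norm_num)⟩

variable {F G : H → X → ℂ} {c A B : ℝ≥0∞} {σ w : X → ℂ}

/-- Where `F` and `G` are given by vectors `k` and `l`, Parseval for the basis gives `∑ F (b i) conj
(G (b i)) = ∑ ⟨k, b i⟩ ⟨b i, l⟩ = ⟨k, l⟩`. The `p = 1` estimate on finite subfamilies bounds the sum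
of the `L¹` norms and justifies exchanging sum and integral; separability makes the basis countable.
-/
theorem BoundedSampling.hasTrace [CompleteSpace H] [TopologicalSpace.SeparableSpace H]
    (hF : BoundedSampling μ F c A)
    (hG : BoundedSampling μ G c B) (hc : c ≠ ∞) (hσ : MemLp σ 1 μ) {P : H →L[ℂ] H}
    (hP : IsSamplingMultiplier μ F G σ P)
    (hw : ∀ᵐ ξ ∂μ, ∃ k l : H, (∀ f, F f ξ = ⟪k, f⟫_ℂ) ∧ (∀ g, G g ξ = ⟪l, g⟫_ℂ) ∧
      w ξ = ⟪k, l⟫_ℂ) :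
    HasTrace P (∫ ξ, σ ξ * w ξ ∂μ) := by
  intro ι b
  have : Countable ι := countable_of_orthonormal b.orthonormal
  have hsum : Summable fun i => ∫ ξ, ‖σ ξ * F (b i) ξ * conj (G (b i) ξ)‖ ∂μ := by
    refine summable_of_sum_le (c := (c ^ 2 * eLpNorm σ 1 μ).toReal)
      (fun i => integral_nonneg fun ξ => norm_nonneg _) fun s => ?_
    have hb : Orthonormal ℂ fun i : s => b i := b.orthonormal.comp _ Subtype.val_injective
    have h := hF.sum_lintegral_rpow_le hG hc hσ.1 le_rfl ENNReal.one_ne_top hb hb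
    simp only [ENNReal.toReal_one, ENNReal.rpow_one, inv_one, mul_one, sub_self, ENNReal.rpow_zero,
      ENNReal.rpow_two] at h
    refine (ENNReal.ofReal_le_iff_le_toReal
      (ENNReal.mul_ne_top (ENNReal.pow_ne_top hc) hσ.2.ne)).1 (le_trans (le_of_eq ?_) h)
    rw [ENNReal.ofReal_sum_of_nonneg fun i _ => integral_nonneg fun ξ => norm_nonneg _,
      ← Finset.sum_coe_sort]
    refine Finset.sum_congr rfl fun i _ => ?_
    rw [ofReal_integral_norm_eq_lintegral_enorm (hP _ _).1]
    simp only [enorm_mul_mul_conj]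
  have key := hasSum_integral_of_summable_integral_norm (μ := μ)
    (F := fun i ξ => σ ξ * F (b i) ξ * conj (G (b i) ξ)) (fun i => (hP (b i) (b i)).1) hsum
  simp only [← (hP _ _).2] at key
  rw [show ∫ ξ, σ ξ * w ξ ∂μ =
    ∫ ξ, ∑' i, σ ξ * F (b i) ξ * conj (G (b i) ξ) ∂μ from integral_congr_ae ?_]
  · exact key
  filter_upwards [hw] with ξ ⟨k, l, hk, hl, hkl⟩
  simp only [hk, hl, hkl, inner_conj_symm, mul_assoc]
  exact ((b.hasSum_inner_mul_inner k l).mul_left (σ ξ)).tsum_eq.symm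

end Trace

end Sampling

/-! ### The integral transform with a bounded kernel -/

section Kernel

variable {X : Type*} [MeasurableSpace X] {μ : Measure X}
variable {K : X → X → ℂ} {c : ℝ}

theorem transform_congr_ae {h h' : X → ℂ} (hh : h =ᵐ[μ] h') :
    transform K μ h = transform K μ h' := by
  funext ξ
  refine integral_congr_ae ?_
  filter_upwards [hh] with x hx
  rw [hx]

/-- The multiplier is `ψ̄ F_σ φ` when `F_σ` is given by the `L²` transform. -/
theorem IsWaveletMultiplier.ae_eq_adjoint {U : Lp ℂ 2 μ →ₗᵢ[ℂ] Lp ℂ 2 μ}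
    (hU : ∀ h : Lp ℂ 2 μ, Integrable h μ → U h =ᵐ[μ] transform K μ h) {φ ψ σ : X → ℂ}
    (hφ2 : MemLp φ 2 μ) (hψ2 : MemLp ψ 2 μ) (hψtop : MemLp ψ ∞ μ)
    {P : Lp ℂ 2 μ →L[ℂ] Lp ℂ 2 μ} (hP : IsWaveletMultiplier K μ φ ψ σ P)
    {f h v : Lp ℂ 2 μ} (hh : h =ᵐ[μ] fun x => φ x * f x) (hv : v =ᵐ[μ] fun ξ => σ ξ * U h ξ) :
    P f =ᵐ[μ] fun x => conj (ψ x) *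
      (ContinuousLinearMap.adjoint U.toContinuousLinearMap v) x := by
  set y := ContinuousLinearMap.adjoint U.toContinuousLinearMap v with hy
  have hw : MemLp (fun x => conj (ψ x) * y x) 2 μ := (Lp.memLp y).mul hψtop.star
  have htr : ∀ {h : Lp ℂ 2 μ} {k : X → ℂ}, h =ᵐ[μ] k → Integrable k μ →
      U h =ᵐ[μ] transform K μ k := by
    intro h k hk hi
    rw [← transform_congr_ae hk]
    exact hU h (hi.congr hk.symm)
  suffices h : P f = hw.toLp by
    rw [h]
    exact hw.coeFn_toLp
  refine ext_inner_left ℂ fun g => ?_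
  have hψg : MemLp (fun x => ψ x * g x) 2 μ := (Lp.memLp g).mul hψtop
  -- Both `φ f` and `ψ g` lie in `L¹ ∩ L²`, where `U` is the integral. Moving `U` and then `ψ`
  -- across the inner product gives the formula.
  calc ⟪g, P f⟫_ℂ = ⟪U hψg.toLp, v⟫_ℂ := by
        rw [(hP f g).2, L2.inner_def]
        refine integral_congr_ae ?_
        filter_upwards [hv, htr hh (hφ2.integrable_mul (Lp.memLp f)),
          htr hψg.coeFn_toLp (hψ2.integrable_mul (Lp.memLp g))] with ξ h1 h2 h3
        rw [RCLike.inner_apply, h1, h2, h3]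
    _ = ⟪hψg.toLp, y⟫_ℂ := by
        rw [hy, ContinuousLinearMap.adjoint_inner_right]
        rfl
    _ = ⟪g, hw.toLp⟫_ℂ := by
        rw [L2.inner_def, L2.inner_def]
        refine integral_congr_ae ?_
        filter_upwards [hψg.coeFn_toLp, hw.coeFn_toLp] with x h1 h2
        rw [RCLike.inner_apply, RCLike.inner_apply, h1, h2, map_mul]
        ring

variable [SFinite μ]

/-- The kernel `K` is measurable and bounded by `c`, almost everywhere. -/
structure BoundedKernel (K : X → X → ℂ) (μ : Measure X) (c : ℝ) : Prop where
  nonneg : 0 ≤ c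
  aestronglyMeasurable : AEStronglyMeasurable (Function.uncurry K) (μ.prod μ)
  ae_norm_le : ∀ᵐ z ∂μ.prod μ, ‖Function.uncurry K z‖ ≤ c

namespace BoundedKernel

theorem swap (hK : BoundedKernel K μ c) : BoundedKernel (fun ξ x => K x ξ) μ c where
  nonneg := hK.nonneg
  aestronglyMeasurable := hK.aestronglyMeasurable.prod_swap
  ae_norm_le := Measure.measurePreserving_swap.quasiMeasurePreserving.ae hK.ae_norm_le

theorem ae_section (hK : BoundedKernel K μ c) :
    ∀ᵐ ξ ∂μ, AEStronglyMeasurable (fun x => K x ξ) μ ∧ ∀ᵐ x ∂μ, ‖K x ξ‖ ≤ c := by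
  filter_upwards [hK.swap.aestronglyMeasurable.prodMk_left, Measure.ae_ae_of_ae_prod
    hK.swap.ae_norm_le] with ξ h1 h2
  exact ⟨h1, h2⟩

/-- The exceptional null set does not depend on `h`, so at a good point `ξ` sums and limits of
functions `h` can be treated together. -/
theorem ae_transform (hK : BoundedKernel K μ c) :
    ∀ᵐ ξ ∂μ, ∀ h : X → ℂ, Integrable h μ → Integrable (fun x => h x * K x ξ) μ ∧
      ‖transform K μ h ξ‖ ≤ c * ∫ x, ‖h x‖ ∂μ := by
  filter_upwards [hK.ae_section] with ξ ⟨h1, h2⟩ h hh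
  have hint : Integrable (fun x => h x * K x ξ) μ := hh.mul_bdd h1 h2
  refine ⟨hint, ?_⟩
  rw [transform, ← integral_const_mul]
  refine norm_integral_le_of_norm_le (hh.norm.const_mul c) ?_
  filter_upwards [h2] with x hx
  rw [norm_mul, mul_comm]
  gcongr

theorem aestronglyMeasurable_transform (hK : BoundedKernel K μ c) {h : X → ℂ}
    (hh : AEStronglyMeasurable h μ) : AEStronglyMeasurable (transform K μ h) μ :=
  (hh.comp_snd.mul hK.swap.aestronglyMeasurable).integral_prod_right'

/-- For almost every `ξ`, the transform of `φ f` at `ξ` is the inner product of `f` with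
`conj (φ K(·, ξ))`. -/
theorem ae_exists_repr (hK : BoundedKernel K μ c) {φ : X → ℂ} (hφ : MemLp φ 2 μ) :
    ∀ᵐ ξ ∂μ, ∃ k : Lp ℂ 2 μ, (k =ᵐ[μ] fun x => conj (φ x * K x ξ)) ∧
      ‖k‖ₑ ≤ ENNReal.ofReal c * eLpNorm φ 2 μ ∧
      ∀ f : Lp ℂ 2 μ, transform K μ (fun x => φ x * f x) ξ = ⟪k, f⟫_ℂ := by
  filter_upwards [hK.ae_section] with ξ ⟨h1, h2⟩
  have hle : ∀ᵐ x ∂μ, ‖conj (φ x * K x ξ)‖ ≤ c * ‖φ x‖ := by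
    filter_upwards [h2] with x hx
    rw [RCLike.norm_conj, norm_mul, mul_comm]
    gcongr
  have hk : MemLp (fun x => conj (φ x * K x ξ)) 2 μ := hφ.of_le_mul
    (Complex.continuous_conj.comp_aestronglyMeasurable (hφ.1.mul h1)) hle
  refine ⟨hk.toLp, hk.coeFn_toLp, ?_, fun f => ?_⟩
  · rw [Lp.enorm_toLp]
    exact eLpNorm_le_mul_eLpNorm_of_ae_le_mul hle 2
  · rw [L2.inner_def, transform]
    refine integral_congr_ae ?_
    filter_upwards [hk.coeFn_toLp] with x hx
    rw [RCLike.inner_apply, hx, Complex.conj_conj]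
    ring

/-- The pointwise constant `c` comes from `‖φ‖₂ = 1` and the bound on the kernel; the `L²` constant
comes from `U` being an isometry that agrees with the transform at `φ f`. -/
theorem boundedSampling (hK : BoundedKernel K μ c) {U : Lp ℂ 2 μ →ₗᵢ[ℂ] Lp ℂ 2 μ}
    (hU : ∀ h : Lp ℂ 2 μ, Integrable h μ → U h =ᵐ[μ] transform K μ h) {φ : X → ℂ}
    (hφ2 : MemLp φ 2 μ) (hφtop : MemLp φ ∞ μ) (hφ1 : eLpNorm φ 2 μ = 1) :
    BoundedSampling μ (fun f : Lp ℂ 2 μ => transform K μ (fun x => φ x * f x))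
      (ENNReal.ofReal c) (eLpNorm φ ∞ μ) where
  ae_repr := by
    filter_upwards [hK.ae_exists_repr hφ2] with ξ ⟨k, _, hk, h⟩
    exact ⟨k, by simpa [hφ1] using hk, h⟩
  aestronglyMeasurable f :=
    hK.aestronglyMeasurable_transform (hφ2.1.mul (Lp.aestronglyMeasurable f))
  eLpNorm_le f := by
    have hm : MemLp (fun x => φ x * f x) 2 μ := (Lp.memLp f).mul hφtop
    have hi : Integrable (fun x => φ x * f x) μ := hφ2.integrable_mul (Lp.memLp f)
    have h1 := hU hm.toLp (hi.congr hm.coeFn_toLp.symm)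
    rw [transform_congr_ae hm.coeFn_toLp] at h1
    calc eLpNorm (transform K μ (fun x => φ x * f x)) 2 μ = ‖U hm.toLp‖ₑ := by
          rw [Lp.enorm_def, eLpNorm_congr_ae h1]
      _ = eLpNorm (fun x => φ x * f x) 2 μ := by
          rw [← ofReal_norm, U.norm_map, ofReal_norm, Lp.enorm_toLp]
      _ ≤ eLpNorm φ ∞ μ * eLpNorm f 2 μ :=
          eLpNorm_smul_le_eLpNorm_top_mul_eLpNorm 2 (Lp.aestronglyMeasurable f) φ
      _ = eLpNorm φ ∞ μ * ‖f‖ₑ := by rw [Lp.enorm_def]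

/-- The multiplier is `ψ̄ F_σ φ` when `F_σ` is given by an absolutely convergent integral. -/
theorem ae_eq_multiplierIntegral (hK : BoundedKernel K μ c) {φ ψ σ : X → ℂ}
    (hψ2 : MemLp ψ 2 μ) {P : Lp ℂ 2 μ →L[ℂ] Lp ℂ 2 μ} (hP : IsWaveletMultiplier K μ φ ψ σ P)
    (f : Lp ℂ 2 μ)
    (hf : Integrable (fun ξ => σ ξ * transform K μ (fun x => φ x * f x) ξ) μ) :
    P f =ᵐ[μ] fun x => conj (ψ x) * multiplierIntegral K μ σ (fun y => φ y * f y) x := by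
  set S : X → ℂ := fun ξ => σ ξ * transform K μ (fun x => φ x * f x) ξ with hS
  have hmeas : AEStronglyMeasurable (multiplierIntegral K μ σ (fun y => φ y * f y)) μ :=
    (hf.1.comp_snd.mul (Complex.continuous_conj.comp_aestronglyMeasurable
      hK.aestronglyMeasurable)).integral_prod_right'
  have hbdd : ∀ᵐ x ∂μ, ‖multiplierIntegral K μ σ (fun y => φ y * f y) x‖ ≤
      c * ∫ ξ, ‖S ξ‖ ∂μ := by
    filter_upwards [hK.swap.ae_section] with x ⟨_, h2⟩
    rw [multiplierIntegral, ← integral_const_mul]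
    refine norm_integral_le_of_norm_le (hf.norm.const_mul c) ?_
    filter_upwards [h2] with ξ hξ
    rw [norm_mul, RCLike.norm_conj, mul_comm]
    gcongr
  have hw : MemLp (fun x => conj (ψ x) * multiplierIntegral K μ σ (fun y => φ y * f y) x) 2 μ := by
    refine hψ2.of_le_mul (c := c * ∫ ξ, ‖S ξ‖ ∂μ)
      ((Complex.continuous_conj.comp_aestronglyMeasurable hψ2.1).mul hmeas) ?_
    filter_upwards [hbdd] with x hx
    rw [norm_mul, RCLike.norm_conj, mul_comm]
    gcongr
  suffices h : P f = hw.toLp by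
    rw [h]
    exact hw.coeFn_toLp
  refine ext_inner_left ℂ fun g => ?_
  have hψg : Integrable (fun x => ψ x * g x) μ := hψ2.integrable_mul (Lp.memLp g)
  -- Fubini applies since the integrand is a tensor product of two integrable functions times the
  -- bounded kernel.
  have hprod : Integrable (Function.uncurry fun x ξ => S ξ * conj (ψ x * g x * K x ξ))
      (μ.prod μ) := by
    have h1 : Integrable (fun z : X × X => conj (ψ z.1 * g z.1) * S z.2) (μ.prod μ) :=
      (Complex.conjLIE.toContinuousLinearEquiv.toContinuousLinearMap.integrable_comp
        hψg).mul_prod hf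
    refine (h1.mul_bdd (c := c) (g := fun z => conj (Function.uncurry K z))
      (Complex.continuous_conj.comp_aestronglyMeasurable hK.aestronglyMeasurable) ?_).congr
      (ae_of_all _ fun z => ?_)
    · filter_upwards [hK.ae_norm_le] with z hz
      rwa [RCLike.norm_conj]
    · simp only [Function.uncurry, map_mul]
      ring
  calc ⟪g, P f⟫_ℂ = ∫ ξ, ∫ x, S ξ * conj (ψ x * g x * K x ξ) ∂μ ∂μ := by
        rw [(hP f g).2]
        refine integral_congr_ae (ae_of_all _ fun ξ => ?_)
        simp only
        rw [integral_const_mul, integral_conj]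
        rfl
    _ = ∫ x, ∫ ξ, S ξ * conj (ψ x * g x * K x ξ) ∂μ ∂μ := (integral_integral_swap hprod).symm
    _ = ⟪g, hw.toLp⟫_ℂ := by
        rw [L2.inner_def]
        refine integral_congr_ae ?_
        filter_upwards [hw.coeFn_toLp] with x hx
        rw [RCLike.inner_apply, hx, multiplierIntegral, mul_right_comm, ← integral_const_mul]
        refine integral_congr_ae (ae_of_all _ fun ξ => ?_)
        simp only [hS, map_mul]
        ring

/-- If `U` agrees with the transform along a sequence converging in `L¹` and in `L²`, it does so
at the limit. -/
theorem ae_eq_transform_of_tendsto (hK : BoundedKernel K μ c) {U : Lp ℂ 2 μ →ₗᵢ[ℂ] Lp ℂ 2 μ}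
    {h : Lp ℂ 2 μ} {s : ℕ → Lp ℂ 2 μ} (hh : Integrable h μ) (hs : ∀ n, Integrable (s n) μ)
    (hUs : ∀ n, U (s n) =ᵐ[μ] transform K μ (s n))
    (h1 : Filter.Tendsto (fun n => ∫ x, ‖s n x - h x‖ ∂μ) Filter.atTop (nhds 0))
    (h2 : Filter.Tendsto s Filter.atTop (nhds h)) : U h =ᵐ[μ] transform K μ h := by
  have h3 : Filter.Tendsto (fun n => U (s n)) Filter.atTop (nhds (U h)) :=
    (U.continuous.tendsto h).comp h2
  -- `L²` convergence of `U (s n)` gives almost everywhere convergence along a subsequence, and `L¹`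
  -- convergence of `s n` gives pointwise convergence of the transforms almost everywhere; the two
  -- limits must coincide.
  obtain ⟨ns, hns, hlim⟩ := (tendstoInMeasure_of_tendsto_Lp h3).exists_seq_tendsto_ae
  filter_upwards [hlim, ae_all_iff.2 hUs, hK.ae_transform] with ξ hξ hUξ hKξ
  suffices h6 : Filter.Tendsto (fun n => transform K μ (s n) ξ) Filter.atTop
      (nhds (transform K μ h ξ)) by
    simp only [hUξ] at hξ
    exact tendsto_nhds_unique hξ (h6.comp hns.tendsto_atTop)
  rw [tendsto_iff_norm_sub_tendsto_zero]
  have h4 : Filter.Tendsto (fun n => c * ∫ x, ‖s n x - h x‖ ∂μ) Filter.atTop (nhds 0) := by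
    simpa using h1.const_mul c
  refine squeeze_zero (fun n => norm_nonneg _) (fun n => ?_) h4
  have h5 : transform K μ (s n) ξ - transform K μ h ξ =
      transform K μ (fun x => s n x - h x) ξ := by
    simp only [transform, sub_mul]
    exact (integral_sub (hKξ _ (hs n)).1 (hKξ _ hh).1).symm
  rw [h5]
  exact (hKξ _ ((hs n).sub hh)).2

end BoundedKernel

end Kernel

/-! ### The uncertainty inequality -/

section Uncertainty

variable {X : Type*} [MeasurableSpace X] {μ : Measure X}
variable {H : Type*} [NormedAddCommGroup H] [InnerProductSpace ℂ H]
variable {F G : H → X → ℂ} {c A B : ℝ≥0∞}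

theorem memLp_top_indicator_one {S : Set X} (hS : NullMeasurableSet S μ) :
    MemLp (S.indicator fun _ => (1 : ℂ)) ∞ μ :=
  memLp_top_of_bound (aestronglyMeasurable_const.indicator₀ hS) 1 <| ae_of_all _ fun x =>
    (norm_indicator_le_norm_self _ x).trans (by simp)

theorem BoundedSampling.enorm_indicator_le (hF : BoundedSampling μ F c A)
    (hG : BoundedSampling μ G c B) (hc : c ≠ ∞) (hc0 : c ≠ 0) (hA : A ≠ ∞) (hB : B ≠ ∞)
    {S : Set X} (hS : NullMeasurableSet S μ) {P : H →L[ℂ] H}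
    (hP : IsSamplingMultiplier μ F G (S.indicator fun _ => 1) P) : ‖P‖ₑ ≤ c ^ 2 * μ S := by
  -- If `μ S = ∞`, then `c ≠ 0` makes the right-hand side infinite; otherwise the indicator is in
  -- `L¹` with norm `μ S`.
  rcases eq_or_ne (μ S) ∞ with h | h
  · rw [h, ENNReal.mul_top (pow_ne_zero 2 hc0)]
    exact le_top
  · have h1 : eLpNorm (S.indicator fun _ => (1 : ℂ)) 1 μ = μ S := by
      simpa using eLpNorm_indicator_const₀ (c := (1 : ℂ)) (p := 1) hS one_ne_zero
        ENNReal.one_ne_top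
    have hmem : MemLp (S.indicator fun _ => (1 : ℂ)) 1 μ :=
      ⟨aestronglyMeasurable_const.indicator₀ hS, h1 ▸ h.lt_top⟩
    simpa [h1] using hF.enorm_le hG hc hA hB hmem le_rfl hP

/-- From `f = S (T f) - S (T f - f) - (S f - f)`, where the contraction `S` does not enlarge the
second error. -/
theorem one_sub_sub_le_of_isLocalized {S T : H →L[ℂ] H} (hS : ‖S‖ ≤ 1) {f : H} {ε₁ ε₂ : ℝ}
    (h₁ : IsLocalized ε₁ S f) (h₂ : IsLocalized ε₂ T f) : 1 - ε₁ - ε₂ ≤ ‖S‖ * ‖T‖ := by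
  have hf : 0 < ‖f‖ := norm_pos_iff.2 h₁.1
  have h3 : ‖S (T f - f)‖ ≤ ε₂ * ‖f‖ :=
    (S.le_opNorm _).trans ((mul_le_of_le_one_left (norm_nonneg _) hS).trans h₂.2)
  have h4 : ‖S (T f)‖ ≤ ‖S‖ * ‖T‖ * ‖f‖ := by
    rw [mul_assoc]
    exact (S.le_opNorm _).trans (mul_le_mul_of_nonneg_left (T.le_opNorm f) (norm_nonneg _))
  have h5 : ‖f‖ ≤ ‖S (T f)‖ + ‖S (T f - f)‖ + ‖S f - f‖ := by
    have h6 : f = S (T f) - S (T f - f) - (S f - f) := by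
      rw [map_sub]
      abel
    conv_lhs => rw [h6]
    exact (norm_sub_le _ _).trans (add_le_add_left (norm_sub_le _ _) _)
  have h6 := h₁.2
  refine le_of_mul_le_mul_right ?_ hf
  linarith

theorem BoundedSampling.uncertainty {c : ℝ} (hF : BoundedSampling μ F (ENNReal.ofReal c) A)
    (hG : BoundedSampling μ G (ENNReal.ofReal c) B) (hA : A ≠ ∞) (hB : B ≠ ∞) (hAB : A * B = 1)
    (hc : 0 ≤ c) {S T : Set X} (hS : NullMeasurableSet S μ) (hT : NullMeasurableSet T μ)
    {PS PT : H →L[ℂ] H} (hPS : IsSamplingMultiplier μ F G (S.indicator fun _ => 1) PS)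
    (hPT : IsSamplingMultiplier μ F G (T.indicator fun _ => 1) PT) {f : H} {ε₁ ε₂ : ℝ}
    (h₁ : IsLocalized ε₁ PS f) (h₂ : IsLocalized ε₂ PT f) :
    ENNReal.ofReal (c ^ (-4 : ℤ) * (1 - ε₁ - ε₂)) ≤ μ S * μ T := by
  -- For `c = 0` the power `c ^ (-4)` is `0` by convention, and the claim is trivial.
  rcases hc.eq_or_lt with rfl | hc0
  · simp
  have hctop : ENNReal.ofReal c ≠ ∞ := ENNReal.ofReal_ne_top
  have hcne : ENNReal.ofReal c ≠ 0 := (ENNReal.ofReal_pos.2 hc0).ne'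
  -- The `p = ∞` bound, with `A B = 1`, makes `PS` a contraction; the `p = 1` bounds below bring in
  -- the two measures.
  have hPS1 : ‖PS‖ ≤ 1 := by
    have h := hF.enorm_le hG hctop hA hB (memLp_top_indicator_one hS) le_top hPS
    have h1 : eLpNorm (S.indicator fun _ => (1 : ℂ)) ∞ μ ≤ 1 := by
      refine (eLpNorm_indicator_le _).trans ?_
      rw [eLpNorm_exponent_top]
      exact eLpNormEssSup_le_of_ae_enorm_bound (ae_of_all _ fun x => by simp)
    have h2 : ‖PS‖ₑ ≤ 1 := h.trans (by simpa [hAB] using h1)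
    rw [← ofReal_norm, ← ENNReal.ofReal_one] at h2
    exact (ENNReal.ofReal_le_ofReal_iff zero_le_one).1 h2
  have h3 := ENNReal.ofReal_le_ofReal (one_sub_sub_le_of_isLocalized hPS1 h₁ h₂)
  rw [ENNReal.ofReal_mul (norm_nonneg _), ofReal_norm, ofReal_norm] at h3
  have h4 := h3.trans (mul_le_mul' (hF.enorm_indicator_le hG hctop hcne hA hB hS hPS)
    (hF.enorm_indicator_le hG hctop hcne hA hB hT hPT))
  have h5 : ENNReal.ofReal (c ^ (-4 : ℤ)) * ENNReal.ofReal c ^ 4 = 1 := by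
    rw [← ENNReal.ofReal_pow hc, ← ENNReal.ofReal_mul (by positivity), zpow_neg]
    rw [show (c ^ (4 : ℤ))⁻¹ * c ^ 4 = 1 from inv_mul_cancel₀ (by positivity)]
    simp
  calc ENNReal.ofReal (c ^ (-4 : ℤ) * (1 - ε₁ - ε₂))
      = ENNReal.ofReal (c ^ (-4 : ℤ)) * ENNReal.ofReal (1 - ε₁ - ε₂) :=
        ENNReal.ofReal_mul (by positivity)
    _ ≤ ENNReal.ofReal (c ^ (-4 : ℤ)) *
        (ENNReal.ofReal c ^ 2 * μ S * (ENNReal.ofReal c ^ 2 * μ T)) := by gcongr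
    _ = ENNReal.ofReal (c ^ (-4 : ℤ)) * ENNReal.ofReal c ^ 4 * (μ S * μ T) := by ring
    _ = μ S * μ T := by rw [h5, one_mul]

end Uncertainty

/-! ### The cone: null boundary, temperate growth, measurable kernel -/

section ConeMeasure

variable {d : ℕ}

/-- A null set of Lebesgue measure is a null set of the measure in polar coordinates. -/
theorem ae_polar_notMem {s : Set (E d)} (hs : MeasurableSet s) (h0 : volume s = 0) :
    ∀ᵐ z ∂(volume : Measure (E d)).toSphere.prod ((volume : Measure ℝ).restrict (Ioi 0)),
      z.2 • (z.1 : E d) ∉ s := by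
  have hmeas : MeasurableSet {z : Metric.sphere (0 : E d) 1 × ℝ | z.2 • (z.1 : E d) ∉ s} := by
    have : Measurable fun z : Metric.sphere (0 : E d) 1 × ℝ => z.2 • (z.1 : E d) := by fun_prop
    exact this hs.compl
  have hmeas' : MeasurableSet
      {z : Metric.sphere (0 : E d) 1 × Ioi (0 : ℝ) | (z.2 : ℝ) • (z.1 : E d) ∉ s} := by
    have : Measurable fun z : Metric.sphere (0 : E d) 1 × Ioi (0 : ℝ) =>
        (z.2 : ℝ) • (z.1 : E d) := by fun_prop
    exact this hs.compl
  have h1 : ∀ᵐ z ∂(volume : Measure (E d)).toSphere.prod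
      (Measure.volumeIoiPow (Module.finrank ℝ (E d) - 1)), (z.2 : ℝ) • (z.1 : E d) ∉ s := by
    rw [← (Measure.measurePreserving_homeomorphUnitSphereProd
      (volume : Measure (E d))).map_eq, ae_map_iff (Homeomorph.measurable _).aemeasurable hmeas']
    have h2 : ∀ᵐ x ∂(volume : Measure (E d)).restrict {0}ᶜ, x ∉ s :=
      ae_restrict_of_ae (measure_eq_zero_iff_ae_notMem.1 h0)
    rw [ae_restrict_iff_subtype (measurableSet_singleton _).compl] at h2
    filter_upwards [h2] with x hx
    have hx0 : ‖(x : E d)‖ ≠ 0 := norm_ne_zero_iff.2 x.2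
    simpa [smul_smul, hx0] using hx
  rw [Measure.ae_prod_iff_ae_ae hmeas]
  filter_upwards [Measure.ae_ae_of_ae_prod h1] with ζ hζ
  rw [ae_restrict_iff_subtype measurableSet_Ioi]
  -- The radial density of Lebesgue measure is positive on `(0, ∞)`, so the radial part has the same
  -- null sets as `dr`.
  refine (withDensity_absolutelyContinuous' ?_ ?_).ae_le hζ
  · fun_prop
  · refine ae_of_all _ fun r => ?_
    have : (0 : ℝ) < r := r.2
    exact (ENNReal.ofReal_pos.2 (by positivity)).ne'

/-- A convex set has Lebesgue-null boundary, and both polar factors are absolutely continuous with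
respect to those of Lebesgue measure. Passing to the open interior avoids any measurability
assumption on `Ω`. -/
theorem ae_coneMeasure_mem_interior (Ω : ConvexCone ℝ (E d)) (a : ℝ)
    (Q : Metric.sphere (0 : E d) 1 → ℝ) :
    ∀ᵐ x ∂coneMeasure Ω a Q, x ∈ interior (Ω : Set (E d)) := by
  have hfr : volume (frontier (Ω : Set (E d))) = 0 := Ω.convex.addHaar_frontier volume
  set ν : Measure (E d) := Measure.map (fun z : Metric.sphere (0 : E d) 1 × ℝ => z.2 • (z.1 : E d))
    (((volume : Measure (E d)).toSphere.withDensity fun ζ => ENNReal.ofReal (Q ζ)).prod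
      (((volume : Measure ℝ).restrict (Ioi 0)).withDensity
        fun r => ENNReal.ofReal (r ^ (2 * a - 1)))) with hν
  have hae : ∀ᵐ x ∂ν, x ∉ frontier (Ω : Set (E d)) := by
    rw [hν, ae_map_iff (Measurable.aemeasurable (by fun_prop)) isClosed_frontier.measurableSet.compl]
    exact ((withDensity_absolutelyContinuous _ _).prod
      (withDensity_absolutelyContinuous _ _)).ae_le
      (ae_polar_notMem isClosed_frontier.measurableSet hfr)
  -- The closure is measurable even if `Ω` is not, and restriction to `Ω` is dominated by
  -- restriction to the closure.
  have hcl : ∀ᵐ x ∂coneMeasure Ω a Q, x ∈ closure (Ω : Set (E d)) := by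
    have h1 := ae_restrict_mem (μ := ν) (isClosed_closure (s := (Ω : Set (E d)))).measurableSet
    exact Measure.absolutelyContinuous_of_le (Measure.restrict_mono subset_closure le_rfl) |>.ae_le h1
  filter_upwards [hcl, ae_restrict_of_ae hae] with x h1 h2
  by_contra h3
  exact h2 ⟨h1, h3⟩

/-- Near `0` the exponent `2a - 1 > -1` suffices; beyond `1` the integrand is at most `r ^ (2a - 1 -
n)`, whose exponent is below `-1`. -/
theorem integrableOn_one_add_rpow_neg_mul_rpow {a : ℝ} (ha : 0 < a) {n : ℕ} (hn : 2 * a < n) :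
    IntegrableOn (fun r : ℝ => (1 + r) ^ (-(n : ℝ)) * r ^ (2 * a - 1)) (Ioi 0) := by
  have hm : Measurable fun r : ℝ => (1 + r) ^ (-(n : ℝ)) * r ^ (2 * a - 1) := by fun_prop
  rw [← Ioc_union_Ioi_eq_Ioi zero_le_one]
  refine IntegrableOn.union ?_ ?_
  · have h1 : IntegrableOn (fun r : ℝ => r ^ (2 * a - 1)) (Ioc 0 1) :=
      (intervalIntegrable_iff_integrableOn_Ioc_of_le zero_le_one).1
        (intervalIntegral.intervalIntegrable_rpow' (by linarith))
    refine Integrable.mono' h1 hm.aestronglyMeasurable ?_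
    filter_upwards [ae_restrict_mem measurableSet_Ioc] with r hr
    have hr0 : 0 < r := hr.1
    rw [Real.norm_of_nonneg (by positivity)]
    refine mul_le_of_le_one_left (by positivity) ?_
    exact Real.rpow_le_one_of_one_le_of_nonpos (by linarith) (by simp)
  · have h1 : IntegrableOn (fun r : ℝ => r ^ (-(n : ℝ) + (2 * a - 1))) (Ioi 1) :=
      integrableOn_Ioi_rpow_of_lt (by linarith) zero_lt_one
    refine Integrable.mono' h1 hm.aestronglyMeasurable ?_
    filter_upwards [ae_restrict_mem measurableSet_Ioi] with r hr
    have hr0 : (0 : ℝ) < r := zero_lt_one.trans hr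
    rw [Real.norm_of_nonneg (by positivity), Real.rpow_add hr0]
    gcongr ?_ * _
    exact Real.rpow_le_rpow_of_nonpos hr0 (by linarith) (by simp)

/-- In polar coordinates the weight depends on `r` alone and the angular measure is finite, so only
the radial integral has to converge. -/
theorem hasTemperateGrowth_coneMeasure (Ω : ConvexCone ℝ (E d)) {a : ℝ} (ha : 0 < a)
    {Q : Metric.sphere (0 : E d) 1 → ℝ}
    (hQ : Integrable Q (volume : Measure (E d)).toSphere) :
    (coneMeasure Ω a Q).HasTemperateGrowth := by
  obtain ⟨n, hn⟩ := exists_nat_gt (2 * a)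
  refine ⟨n, Integrable.restrict ?_⟩
  have hmeas : Measurable fun x : E d => (1 + ‖x‖) ^ (-(n : ℝ)) := by fun_prop
  rw [integrable_map_measure hmeas.aestronglyMeasurable (Measurable.aemeasurable (by fun_prop))]
  have : IsFiniteMeasure
      ((volume : Measure (E d)).toSphere.withDensity fun ζ => ENNReal.ofReal (Q ζ)) :=
    isFiniteMeasure_withDensity_ofReal hQ.2
  have hr : Integrable (fun r : ℝ => (1 + |r|) ^ (-(n : ℝ)))
      (((volume : Measure ℝ).restrict (Ioi 0)).withDensity
        fun r => ENNReal.ofReal (r ^ (2 * a - 1))) := by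
    rw [integrable_withDensity_iff_integrable_smul' (by fun_prop) (ae_of_all _ fun _ =>
      ENNReal.ofReal_lt_top)]
    refine (integrableOn_one_add_rpow_neg_mul_rpow ha hn).congr ?_
    filter_upwards [ae_restrict_mem measurableSet_Ioi] with r hr
    have hr0 : (0 : ℝ) < r := hr
    rw [ENNReal.toReal_ofReal (by positivity), abs_of_pos hr0, smul_eq_mul, mul_comm]
  refine (hr.comp_snd _).congr (ae_of_all _ fun z => ?_)
  simp [norm_smul]

theorem boundedKernel_coneMeasure {Ω : ConvexCone ℝ (E d)}
    (hΩ : (interior (Ω : Set (E d))).Nonempty) {μ : Measure (E d)} [SFinite μ]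
    (hμ : ∀ᵐ x ∂μ, x ∈ interior (Ω : Set (E d))) {K : E d → E d → ℂ} {c : ℝ}
    (hKcont : ContinuousOn (Function.uncurry K) ((Ω : Set (E d)) ×ˢ (Ω : Set (E d))))
    (hKbdd : ∀ x ∈ Ω, ∀ ξ ∈ Ω, ‖K x ξ‖ ≤ c) : BoundedKernel K μ c := by
  obtain ⟨x₀, hx₀⟩ := hΩ
  have hmem : ∀ᵐ z ∂μ.prod μ,
      z ∈ interior (Ω : Set (E d)) ×ˢ interior (Ω : Set (E d)) := by
    filter_upwards [Measure.quasiMeasurePreserving_fst.ae hμ,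
      Measure.quasiMeasurePreserving_snd.ae hμ] with z h1 h2
    exact ⟨h1, h2⟩
  refine ⟨(norm_nonneg _).trans (hKbdd x₀ (interior_subset hx₀) x₀ (interior_subset hx₀)), ?_, ?_⟩
  · rw [← Measure.restrict_eq_self_of_ae_mem hmem]
    exact (hKcont.mono (prod_mono interior_subset interior_subset)).aestronglyMeasurable
      (isOpen_interior.measurableSet.prod isOpen_interior.measurableSet)
  · filter_upwards [hmem] with z hz
    exact hKbdd _ (interior_subset hz.1) _ (interior_subset hz.2)

end ConeMeasure

/-! ### Schwartz approximation in two norms -/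

section Approximation

variable {V : Type*} [NormedAddCommGroup V] [MeasurableSpace V] {μ : Measure V}

theorem isFiniteMeasureOnCompacts_of_hasTemperateGrowth [h : μ.HasTemperateGrowth] :
    IsFiniteMeasureOnCompacts μ := by
  refine ⟨fun k hk => ?_⟩
  obtain ⟨n, hn⟩ := h.exists_integrable
  obtain ⟨R, hR⟩ := hk.isBounded.exists_norm_le
  rcases k.eq_empty_or_nonempty with rfl | ⟨x₀, hx₀⟩
  · simp
  have hR0 : 0 ≤ R := (norm_nonneg _).trans (hR x₀ hx₀)
  refine lt_of_le_of_lt (measure_mono fun x hx => ?_)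
    (hn.measure_ge_lt_top (ε := (1 + R) ^ (-(n : ℝ))) (by positivity))
  exact Real.rpow_le_rpow_of_nonpos (by positivity) (by linarith [hR x hx]) (by simp)

variable [BorelSpace V]

theorem tendsto_eLpNorm_indicator_compl_closedBall {p : ℝ≥0∞} (hp : p ≠ 0) (hp' : p ≠ ∞)
    {h : V → ℂ} (hh : MemLp h p μ) :
    Filter.Tendsto (fun n : ℕ => eLpNorm ((Metric.closedBall (0 : V) n)ᶜ.indicator h) p μ)
      Filter.atTop (nhds 0) := by
  have hp0 : 0 < p.toReal := ENNReal.toReal_pos hp hp'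
  have hfin := lintegral_rpow_enorm_lt_top_of_eLpNorm_lt_top hp hp' hh.2
  have key : Filter.Tendsto (fun n : ℕ => ∫⁻ x,
      ‖(Metric.closedBall (0 : V) n)ᶜ.indicator h x‖ₑ ^ p.toReal ∂μ) Filter.atTop
      (nhds (∫⁻ _, 0 ∂μ)) := by
    refine tendsto_lintegral_of_dominated_convergence' (fun x => ‖h x‖ₑ ^ p.toReal)
      (fun n => (hh.1.indicator Metric.isClosed_closedBall.measurableSet.compl).enorm.pow_const _)
      (fun n => ae_of_all _ fun x => ?_) hfin.ne (ae_of_all _ fun x => ?_)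
    · exact ENNReal.rpow_le_rpow (enorm_indicator_le_enorm_self _ _) hp0.le
    · obtain ⟨N, hN⟩ := exists_nat_ge ‖x‖
      refine tendsto_const_nhds.congr' ?_
      filter_upwards [Filter.eventually_ge_atTop N] with n hn
      have hx : x ∉ (Metric.closedBall (0 : V) n)ᶜ := by
        rw [notMem_compl_iff, mem_closedBall_zero_iff]
        exact hN.trans (Nat.cast_le.2 hn)
      rw [indicator_of_notMem hx, enorm_zero, ENNReal.zero_rpow_of_pos hp0]
  simp only [eLpNorm_eq_lintegral_rpow_enorm_toReal hp hp']
  have h2 := (ENNReal.continuous_rpow_const (y := 1 / p.toReal)).tendsto 0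
  rw [ENNReal.zero_rpow_of_pos (by positivity)] at h2
  rw [lintegral_zero] at key
  exact h2.comp key

variable [NormedSpace ℝ V] [FiniteDimensional ℝ V] [IsFiniteMeasureOnCompacts μ]

/-- Simultaneous approximation by Schwartz functions in `L¹` and `L²`. -/
theorem exists_schwartzMap_eLpNorm_sub_le {h : V → ℂ} (h1 : MemLp h 1 μ) (h2 : MemLp h 2 μ)
    {ε : ℝ≥0∞} (hε : 0 < ε) :
    ∃ s : 𝓢(V, ℂ), eLpNorm (h - ⇑s) 1 μ ≤ ε ∧ eLpNorm (h - ⇑s) 2 μ ≤ ε := by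
  have hε2 : 0 < ε / 2 := ENNReal.half_pos hε.ne'
  obtain ⟨n, hn1, hn2⟩ := (((tendsto_eLpNorm_indicator_compl_closedBall one_ne_zero
    ENNReal.one_ne_top h1).eventually_le_const hε2).and
    ((tendsto_eLpNorm_indicator_compl_closedBall two_ne_zero
      ENNReal.ofNat_ne_top h2).eventually_le_const hε2)).exists
  -- The cutoff equals `1` on the ball carrying `k`, so `χ k = k` and `h - χ g` is the tail of `h`
  -- plus `χ (k - g)`.
  obtain ⟨χ, hχ⟩ : ∃ χ : ContDiffBump (0 : V), χ.rIn = n + 1 :=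
    ⟨⟨n + 1, n + 2, by positivity, by linarith⟩, rfl⟩
  have hχ2 : MemLp χ 2 μ := χ.continuous.memLp_of_hasCompactSupport χ.hasCompactSupport
  obtain ⟨k, hk⟩ : ∃ k, k = (Metric.closedBall (0 : V) n).indicator h := ⟨_, rfl⟩
  have hkL : MemLp k 2 μ := hk ▸ h2.indicator Metric.isClosed_closedBall.measurableSet
  have hM : 1 + eLpNorm χ 2 μ ≠ ∞ := ENNReal.add_ne_top.2 ⟨ENNReal.one_ne_top, hχ2.2.ne⟩
  have hM0 : 1 + eLpNorm χ 2 μ ≠ 0 := by positivity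
  -- With `‖k - g‖₂ ≤ δ`, the summand `‖χ‖₂` serves the `L¹` bound on `χ (k - g)` by Cauchy–Schwarz,
  -- and the summand `1` serves the `L²` bound, as `0 ≤ χ ≤ 1`.
  obtain ⟨δ, hδ0, hδ⟩ : ∃ δ : ℝ, 0 < δ ∧ ENNReal.ofReal δ ≤ ε / 2 / (1 + eLpNorm χ 2 μ) := by
    obtain ⟨δ, hδ0, hδ⟩ := ENNReal.lt_iff_exists_nnreal_btwn.1 (ENNReal.div_pos hε2.ne' hM)
    exact ⟨δ, by exact_mod_cast hδ0, by simpa using hδ.le⟩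
  obtain ⟨g, hg1, hg2, hg3⟩ := hkL.exist_eLpNorm_sub_le ENNReal.ofNat_ne_top one_le_two hδ0
  have hgL : MemLp g 2 μ := hg2.continuous.memLp_of_hasCompactSupport hg1
  have hcs : HasCompactSupport ((χ : V → ℝ) • g) := hg1.smul_left
  obtain ⟨s, hs⟩ : ∃ s : 𝓢(V, ℂ), ∀ x, s x = χ x • g x :=
    ⟨hcs.toSchwartzMap (χ.contDiff.smul hg2), fun x => rfl⟩
  have hdec : h - ⇑s = (Metric.closedBall (0 : V) n)ᶜ.indicator h + (χ : V → ℝ) • (k - g) := by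
    funext x
    simp only [Pi.sub_apply, Pi.add_apply, Pi.smul_apply', hs, hk]
    by_cases hx : x ∈ Metric.closedBall (0 : V) n
    · have hx1 : χ x = 1 := by
        refine χ.one_of_mem_closedBall (Metric.closedBall_subset_closedBall ?_ hx)
        rw [hχ]
        linarith
      simp [hx, hx1]
    · simp [hx, sub_eq_add_neg]
  have hmeas1 : AEStronglyMeasurable ((Metric.closedBall (0 : V) n)ᶜ.indicator h) μ :=
    h1.1.indicator Metric.isClosed_closedBall.measurableSet.compl
  have hkg : AEStronglyMeasurable (k - g) μ := hkL.1.sub hgL.1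
  have hmeas2 : AEStronglyMeasurable ((χ : V → ℝ) • (k - g)) μ := hχ2.1.smul hkg
  have hδM : (1 + eLpNorm χ 2 μ) * ENNReal.ofReal δ ≤ ε / 2 := by
    rw [mul_comm]
    exact (ENNReal.le_div_iff_mul_le (Or.inl hM0) (Or.inl hM)).1 hδ
  refine ⟨s, ?_, ?_⟩
  · rw [hdec, ← ENNReal.add_halves ε]
    refine (eLpNorm_add_le hmeas1 hmeas2 le_rfl).trans (add_le_add hn1 ?_)
    calc eLpNorm ((χ : V → ℝ) • (k - g)) 1 μ ≤ eLpNorm χ 2 μ * eLpNorm (k - g) 2 μ :=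
          eLpNorm_smul_le_mul_eLpNorm (p := 2) (q := 2) (r := 1) hkg hχ2.1
      _ ≤ (1 + eLpNorm χ 2 μ) * ENNReal.ofReal δ := by
          gcongr
          exact le_add_self
      _ ≤ ε / 2 := hδM
  · rw [hdec, ← ENNReal.add_halves ε]
    refine (eLpNorm_add_le hmeas1 hmeas2 one_le_two).trans (add_le_add hn2 ?_)
    calc eLpNorm ((χ : V → ℝ) • (k - g)) 2 μ ≤ eLpNorm (k - g) 2 μ := by
          refine eLpNorm_mono fun x => ?_
          rw [Pi.smul_apply', norm_smul, Real.norm_of_nonneg χ.nonneg]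
          exact mul_le_of_le_one_left (norm_nonneg _) χ.le_one
      _ ≤ 1 * ENNReal.ofReal δ := by rwa [one_mul]
      _ ≤ (1 + eLpNorm χ 2 μ) * ENNReal.ofReal δ := by
          gcongr
          exact le_self_add
      _ ≤ ε / 2 := hδM

end Approximation

/-! ### Extension of the transform to an isometry -/

section Isometry

variable {d : ℕ} {μ : Measure (E d)} [SFinite μ] [μ.HasTemperateGrowth]
variable {K : E d → E d → ℂ} {c : ℝ}

/-- Parseval's identity on the diagonal. It includes that the transform of a Schwartz function is
square integrable: otherwise the left-hand side would vanish, and the function with it. -/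
theorem BoundedKernel.memLp_transform_and_eLpNorm_eq (hK : BoundedKernel K μ c) (h : 𝓢(E d, ℂ))
    (hP : ∫ ξ, transform K μ h ξ * conj (transform K μ h ξ) ∂μ = ∫ x, h x * conj (h x) ∂μ) :
    MemLp (transform K μ h) 2 μ ∧ eLpNorm (transform K μ h) 2 μ = eLpNorm h 2 μ := by
  have hm := hK.aestronglyMeasurable_transform h.continuous.aestronglyMeasurable
  have hh : MemLp h 2 μ := h.memLp 2 μ
  have hsq : ∀ z : ℂ, z * conj z = ((‖z‖ ^ 2 : ℝ) : ℂ) := fun z => by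
    rw [Complex.mul_conj, Complex.normSq_eq_norm_sq]
  simp only [hsq] at hP
  rw [integral_complex_ofReal, integral_complex_ofReal] at hP
  replace hP : ∫ ξ, ‖transform K μ h ξ‖ ^ 2 ∂μ = ∫ x, ‖h x‖ ^ 2 ∂μ := Complex.ofReal_injective hP
  by_cases h0 : ∫ x, ‖h x‖ ^ 2 ∂μ = 0
  · rw [integral_eq_zero_iff_of_nonneg (fun x => by positivity)
      ((memLp_two_iff_integrable_sq_norm hh.1).1 hh)] at h0
    have hz : h =ᵐ[μ] (0 : E d → ℂ) := by
      filter_upwards [h0] with x hx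
      simpa using hx
    have ht : transform K μ h = 0 := by
      rw [transform_congr_ae hz]
      funext ξ
      simp [transform]
    rw [ht, eLpNorm_congr_ae hz]
    exact ⟨MemLp.zero, rfl⟩
  · have hT : MemLp (transform K μ h) 2 μ := by
      rw [memLp_two_iff_integrable_sq_norm hm]
      by_contra hc
      rw [integral_undef hc] at hP
      exact h0 hP.symm
    refine ⟨hT, ?_⟩
    rw [hT.eLpNorm_eq_integral_rpow_norm two_ne_zero ENNReal.ofNat_ne_top,
      hh.eLpNorm_eq_integral_rpow_norm two_ne_zero ENNReal.ofNat_ne_top]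
    simp only [ENNReal.toReal_ofNat, Real.rpow_two, hP]

theorem BoundedKernel.exists_isometry (hK : BoundedKernel K μ c)
    (hP : ∀ h : 𝓢(E d, ℂ), ∫ ξ, transform K μ h ξ * conj (transform K μ h ξ) ∂μ =
      ∫ x, h x * conj (h x) ∂μ) :
    ∃ U : Lp ℂ 2 μ →ₗᵢ[ℂ] Lp ℂ 2 μ, ExtendsTransform K μ U ∧
      ∀ h : Lp ℂ 2 μ, Integrable h μ → U h =ᵐ[μ] transform K μ h := by
  have : IsFiniteMeasureOnCompacts μ := isFiniteMeasureOnCompacts_of_hasTemperateGrowth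
  have hT : ∀ h : 𝓢(E d, ℂ), MemLp (transform K μ h) 2 μ ∧
      eLpNorm (transform K μ h) 2 μ = eLpNorm h 2 μ := fun h =>
    hK.memLp_transform_and_eLpNorm_eq h (hP h)
  let T : 𝓢(E d, ℂ) →ₗ[ℂ] Lp ℂ 2 μ :=
    { toFun := fun h => (hT h).1.toLp
      map_add' := fun h h' => by
        rw [← MemLp.toLp_add, MemLp.toLp_eq_toLp_iff]
        filter_upwards [hK.ae_transform] with ξ hξ
        simp only [transform, Pi.add_apply, add_apply, add_mul]
        exact integral_add (hξ h h.integrable).1 (hξ h' h'.integrable).1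
      map_smul' := fun a h => by
        rw [RingHom.id_apply, ← MemLp.toLp_const_smul, MemLp.toLp_eq_toLp_iff]
        refine ae_of_all _ fun ξ => ?_
        simp only [transform, Pi.smul_apply, smul_apply, smul_eq_mul, mul_assoc]
        exact integral_const_mul _ _ }
  let e : 𝓢(E d, ℂ) →ₗ[ℂ] Lp ℂ 2 μ := (SchwartzMap.toLpCLM ℂ ℂ 2 μ).toLinearMap
  have hTe : ∀ h, ‖T h‖ = ‖e h‖ := fun h => by
    change ‖(hT h).1.toLp‖ = ‖h.toLp 2 μ‖
    rw [Lp.norm_toLp, (hT h).2, SchwartzMap.norm_toLp]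
  have hdense : DenseRange e := SchwartzMap.denseRange_toLpCLM (F := ℂ) ENNReal.ofNat_ne_top
  have hbound : ∀ h, ‖T h‖ ≤ 1 * ‖e h‖ := fun h => by rw [one_mul, hTe]
  -- The map `e` need not be injective, as Schwartz functions may agree almost everywhere for `μ`;
  -- the equality of norms makes `T` factor through `e`.
  set U₀ := T.extendOfNorm e with hU₀
  have hU₀e : ∀ h, U₀ (e h) = T h := fun h => LinearMap.extendOfNorm_eq hdense ⟨1, hbound⟩ h
  have hnorm : ∀ f, ‖U₀ f‖ = ‖f‖ := fun f =>
    hdense.induction_on (p := fun f => ‖U₀ f‖ = ‖f‖) f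
      (isClosed_eq U₀.continuous.norm continuous_norm) fun h => by rw [hU₀e, hTe]
  let U : Lp ℂ 2 μ →ₗᵢ[ℂ] Lp ℂ 2 μ := ⟨U₀.toLinearMap, hnorm⟩
  have hUs : ∀ h : 𝓢(E d, ℂ), U (h.toLp 2 μ) =ᵐ[μ] transform K μ h := fun h => by
    have : U (h.toLp 2 μ) = (hT h).1.toLp := hU₀e h
    rw [this]
    exact (hT h).1.coeFn_toLp
  refine ⟨U, fun h f hf => ?_, fun h hh => ?_⟩
  · have : f = h.toLp 2 μ := Lp.ext (hf.trans (h.coeFn_toLp 2 μ).symm)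
    rw [this]
    exact hUs h
  · have hpos : ∀ n : ℕ, (0 : ℝ≥0∞) < ENNReal.ofReal (1 / ((n : ℝ) + 1)) := fun n =>
      ENNReal.ofReal_pos.2 (by positivity)
    -- To reach all of `L¹ ∩ L²`, approximate `h` in both norms by the same Schwartz functions.
    choose s hs1 hs2 using fun n : ℕ => exists_schwartzMap_eLpNorm_sub_le (μ := μ)
      (memLp_one_iff_integrable.2 hh) (Lp.memLp h) (hpos n)
    have hae : ∀ n, (s n).toLp 2 μ =ᵐ[μ] s n := fun n => (s n).coeFn_toLp 2 μ
    refine hK.ae_eq_transform_of_tendsto (s := fun n => (s n).toLp 2 μ) hh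
      (fun n => (s n).integrable.congr (hae n).symm) (fun n => ?_) ?_ ?_
    · rw [transform_congr_ae (hae n)]
      exact hUs (s n)
    · refine squeeze_zero (fun n => integral_nonneg fun x => norm_nonneg _) (fun n => ?_)
        (tendsto_one_div_add_atTop_nhds_zero_nat (𝕜 := ℝ))
      have h1 : ∫ x, ‖(s n).toLp 2 μ x - h x‖ ∂μ = ∫ x, ‖(h - ⇑(s n) : E d → ℂ) x‖ ∂μ := by
        refine integral_congr_ae ?_
        filter_upwards [hae n] with x hx
        rw [hx, norm_sub_rev, Pi.sub_apply]
      rw [h1, integral_norm_eq_lintegral_enorm (hh.1.sub (s n).continuous.aestronglyMeasurable),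
        ← eLpNorm_one_eq_lintegral_enorm]
      exact ENNReal.toReal_le_of_le_ofReal (by positivity) (hs1 n)
    · rw [tendsto_iff_dist_tendsto_zero]
      refine squeeze_zero (fun n => dist_nonneg) (fun n => ?_)
        (tendsto_one_div_add_atTop_nhds_zero_nat (𝕜 := ℝ))
      rw [dist_comm, Lp.dist_def]
      refine ENNReal.toReal_le_of_le_ofReal (by positivity) ((eLpNorm_congr_ae ?_).trans_le (hs2 n))
      exact Filter.EventuallyEq.rfl.sub (hae n)

end Isometry

/-! ### The trace density -/

section TraceFormula

variable {X : Type*} [MeasurableSpace X] {μ : Measure X} [SFinite μ]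
variable {K : X → X → ℂ} {c : ℝ} {φ ψ σ : X → ℂ}

theorem BoundedKernel.ae_exists_repr_pair (hK : BoundedKernel K μ c) (hφ2 : MemLp φ 2 μ)
    (hψ2 : MemLp ψ 2 μ) (hφ1 : eLpNorm φ 2 μ = 1) (hψ1 : eLpNorm ψ 2 μ = 1) :
    ∀ᵐ ξ ∂μ, ∃ k l : Lp ℂ 2 μ, ‖k‖ ≤ c ∧ ‖l‖ ≤ c ∧
      (∀ f : Lp ℂ 2 μ, transform K μ (fun x => φ x * f x) ξ = ⟪k, f⟫_ℂ) ∧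
      (∀ g : Lp ℂ 2 μ, transform K μ (fun x => ψ x * g x) ξ = ⟪l, g⟫_ℂ) ∧
      ∫ x, conj (ψ x * K x ξ) * (φ x * K x ξ) ∂μ = ⟪k, l⟫_ℂ := by
  filter_upwards [hK.ae_exists_repr hφ2, hK.ae_exists_repr hψ2]
    with ξ ⟨k, hk, hkc, hφk⟩ ⟨l, hl, hlc, hψl⟩
  rw [hφ1, mul_one, ← ofReal_norm, ENNReal.ofReal_le_ofReal_iff hK.nonneg] at hkc
  rw [hψ1, mul_one, ← ofReal_norm, ENNReal.ofReal_le_ofReal_iff hK.nonneg] at hlc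
  refine ⟨k, l, hkc, hlc, hφk, hψl, ?_⟩
  rw [L2.inner_def]
  refine integral_congr_ae ?_
  filter_upwards [hk, hl] with x h1 h2
  rw [RCLike.inner_apply, h1, h2, Complex.conj_conj]

theorem BoundedKernel.integrable_trace_density (hK : BoundedKernel K μ c) (hφ2 : MemLp φ 2 μ)
    (hψ2 : MemLp ψ 2 μ) (hφ1 : eLpNorm φ 2 μ = 1) (hψ1 : eLpNorm ψ 2 μ = 1)
    (hσ : Integrable σ μ) :
    Integrable (fun ξ => σ ξ * ∫ x, conj (ψ x * K x ξ) * (φ x * K x ξ) ∂μ) μ := by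
  have hKs := hK.swap.aestronglyMeasurable
  refine hσ.mul_bdd (c := c * c) ((Complex.continuous_conj.comp_aestronglyMeasurable
    (hψ2.1.comp_snd.mul hKs)).mul (hφ2.1.comp_snd.mul hKs)).integral_prod_right' ?_
  filter_upwards [hK.ae_exists_repr_pair hφ2 hψ2 hφ1 hψ1] with ξ ⟨k, l, hk, hl, _, _, h⟩
  rw [h]
  exact (norm_inner_le_norm k l).trans (mul_le_mul hk hl (norm_nonneg _) hK.nonneg)

end TraceFormula

end WaveletMultiplier

theorem theoremC {d : ℕ}
    -- the cone and its measure
    (Ω : ConvexCone ℝ (WaveletMultiplier.E d))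
    (hΩ : (interior (Ω : Set (WaveletMultiplier.E d))).Nonempty)
    (a : ℝ) (ha : 0 < a)
    (Q : Metric.sphere (0 : WaveletMultiplier.E d) 1 → ℝ)
    (hQint : Integrable Q (volume : Measure (WaveletMultiplier.E d)).toSphere)
    (hQnonneg : ∀ᵐ ζ ∂(volume : Measure (WaveletMultiplier.E d)).toSphere, 0 ≤ Q ζ)
    (hQne : ¬ (Q =ᵐ[(volume : Measure (WaveletMultiplier.E d)).toSphere] 0))
    (μ : Measure (WaveletMultiplier.E d))
    (hμ : μ = WaveletMultiplier.coneMeasure Ω a Q)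
    -- the kernel
    (K : WaveletMultiplier.E d → WaveletMultiplier.E d → ℂ) (c : ℝ)
    (hKcont : ContinuousOn (Function.uncurry K)
      ((Ω : Set (WaveletMultiplier.E d)) ×ˢ (Ω : Set (WaveletMultiplier.E d))))
    (hKbdd : ∀ x ∈ Ω, ∀ ξ ∈ Ω, ‖K x ξ‖ ≤ c)
    (hKhom : ∀ t : ℝ, 0 < t → ∀ x ∈ Ω, ∀ ξ ∈ Ω, K (t • x) ξ = K x (t • ξ))
    -- the Parseval identity for Schwartz functions
    (hParseval : ∀ f g : 𝓢(WaveletMultiplier.E d, ℂ),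
      ∫ ξ, WaveletMultiplier.transform K μ f ξ * conj (WaveletMultiplier.transform K μ g ξ) ∂μ =
        ∫ x, f x * conj (g x) ∂μ)
    -- the windows
    (φ ψ : WaveletMultiplier.E d → ℂ)
    (hφ2 : MemLp φ 2 μ) (hφtop : MemLp φ ∞ μ) (hφ1 : eLpNorm φ 2 μ = 1)
    (hψ2 : MemLp ψ 2 μ) (hψtop : MemLp ψ ∞ μ) (hψ1 : eLpNorm ψ 2 μ = 1) :
    -- the transform extends to an isometry of `L²`
    ∃ U : Lp ℂ 2 μ →ₗᵢ[ℂ] Lp ℂ 2 μ, WaveletMultiplier.ExtendsTransform K μ U ∧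
    -- the wavelet multiplier with symbol in `L^p` is well defined ...
    (∀ (p : ℝ≥0∞) (σ : WaveletMultiplier.E d → ℂ), 1 ≤ p → MemLp σ p μ →
      (∃! P : Lp ℂ 2 μ →L[ℂ] Lp ℂ 2 μ, WaveletMultiplier.IsWaveletMultiplier K μ φ ψ σ P) ∧
      ∀ P : Lp ℂ 2 μ →L[ℂ] Lp ℂ 2 μ, WaveletMultiplier.IsWaveletMultiplier K μ φ ψ σ P →
        -- ... it is the operator `ψ̄ F_σ φ` wherever `F_σ` is given by its integral, or by the
        -- `L²` transform (the adjoint of the isometry `U` is its inverse if `U` is onto) ...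
        (∀ f : Lp ℂ 2 μ,
          Integrable
            (fun ξ => σ ξ * WaveletMultiplier.transform K μ (fun x => φ x * f x) ξ) μ →
          P f =ᵐ[μ] fun x =>
            conj (ψ x) * WaveletMultiplier.multiplierIntegral K μ σ (fun y => φ y * f y) x) ∧
        (∀ f h v : Lp ℂ 2 μ, (h =ᵐ[μ] fun x => φ x * f x) → (v =ᵐ[μ] fun ξ => σ ξ * U h ξ) →
          P f =ᵐ[μ] fun x =>
            conj (ψ x) * (ContinuousLinearMap.adjoint U.toContinuousLinearMap v) x) ∧
        -- ... and it is in the Schatten class `S_p`, with the norm estimates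
        WaveletMultiplier.MemSchatten p P ∧
        WaveletMultiplier.schattenNorm p P ≤
          ENNReal.ofReal (c ^ (2 * (p⁻¹).toReal)) *
            (eLpNorm φ ∞ μ * eLpNorm ψ ∞ μ) ^ (1 - (p⁻¹).toReal) * eLpNorm σ p μ ∧
        ‖P‖ₑ ≤
          ENNReal.ofReal (c ^ (2 * (p⁻¹).toReal)) *
            (eLpNorm φ ∞ μ * eLpNorm ψ ∞ μ) ^ (1 - (p⁻¹).toReal) * eLpNorm σ p μ ∧
        (eLpNorm φ ∞ μ * eLpNorm ψ ∞ μ = 1 →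
          WaveletMultiplier.schattenNorm p P ≤
            ENNReal.ofReal (c ^ (2 * (p⁻¹).toReal)) * eLpNorm σ p μ)) ∧
    -- for `p = 1`: trace class, with the trace formula
    (∀ σ : WaveletMultiplier.E d → ℂ, MemLp σ 1 μ →
      ∀ P : Lp ℂ 2 μ →L[ℂ] Lp ℂ 2 μ, WaveletMultiplier.IsWaveletMultiplier K μ φ ψ σ P →
        WaveletMultiplier.MemSchatten 1 P ∧
        WaveletMultiplier.schattenNorm 1 P ≤ ENNReal.ofReal (c ^ 2) * eLpNorm σ 1 μ ∧
        Integrable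
          (fun ξ => σ ξ * ∫ x, conj (ψ x * K x ξ) * (φ x * K x ξ) ∂μ) μ ∧
        WaveletMultiplier.HasTrace P
          (∫ ξ, σ ξ * ∫ x, conj (ψ x * K x ξ) * (φ x * K x ξ) ∂μ ∂μ)) ∧
    -- the uncertainty inequality
    (eLpNorm φ ∞ μ * eLpNorm ψ ∞ μ = 1 →
      ∀ S T : Set (WaveletMultiplier.E d), NullMeasurableSet S μ → NullMeasurableSet T μ →
      ∀ PS PT : Lp ℂ 2 μ →L[ℂ] Lp ℂ 2 μ,
        WaveletMultiplier.IsWaveletMultiplier K μ φ ψ (S.indicator fun _ => 1) PS →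
        WaveletMultiplier.IsWaveletMultiplier K μ φ ψ (T.indicator fun _ => 1) PT →
      ∀ ε₁ ε₂ : ℝ, 0 ≤ ε₁ → 0 ≤ ε₂ → ε₁ + ε₂ < 1 →
      ∀ f : Lp ℂ 2 μ,
        WaveletMultiplier.IsLocalized ε₁ PS f → WaveletMultiplier.IsLocalized ε₂ PT f →
        ENNReal.ofReal (c ^ (-4 : ℤ) * (1 - ε₁ - ε₂)) ≤ μ S * μ T) := by
  have hmem : ∀ᵐ x ∂μ, x ∈ interior (Ω : Set (WaveletMultiplier.E d)) :=
    hμ ▸ WaveletMultiplier.ae_coneMeasure_mem_interior Ω a Q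
  have hgrowth : μ.HasTemperateGrowth :=
    hμ ▸ WaveletMultiplier.hasTemperateGrowth_coneMeasure Ω ha hQint
  have : IsFiniteMeasureOnCompacts μ :=
    WaveletMultiplier.isFiniteMeasureOnCompacts_of_hasTemperateGrowth
  have hK : WaveletMultiplier.BoundedKernel K μ c :=
    WaveletMultiplier.boundedKernel_coneMeasure hΩ hmem hKcont hKbdd
  obtain ⟨U, hUext, hU⟩ := hK.exists_isometry fun h => hParseval h h
  -- With these families, `IsWaveletMultiplier` unfolds to `IsSamplingMultiplier`, so the abstract
  -- results apply directly.
  have hF := hK.boundedSampling hU hφ2 hφtop hφ1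
  have hG := hK.boundedSampling hU hψ2 hψtop hψ1
  have hc : ENNReal.ofReal c ≠ ∞ := ENNReal.ofReal_ne_top
  have hA : eLpNorm φ ∞ μ ≠ ∞ := hφtop.2.ne
  have hB : eLpNorm ψ ∞ μ ≠ ∞ := hψtop.2.ne
  have hcpow : ∀ p : ℝ≥0∞, ENNReal.ofReal (c ^ (2 * (p⁻¹).toReal)) =
      ENNReal.ofReal c ^ (2 * (p⁻¹).toReal) := fun p =>
    (ENNReal.ofReal_rpow_of_nonneg hK.nonneg (by positivity)).symm
  refine ⟨U, hUext, fun p σ hp hσ => ⟨?_, fun P hP => ?_⟩, fun σ hσ P hP => ?_,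
    fun hAB S T hS hT PS PT hPS hPT ε₁ ε₂ _ _ _ f h₁ h₂ => ?_⟩
  · obtain ⟨P, hP⟩ := hF.exists_isSamplingMultiplier hG hc hA hB hσ hp
    exact ⟨P, hP, fun P' hP' => WaveletMultiplier.IsSamplingMultiplier.unique hP' hP⟩
  · obtain ⟨h1, h2⟩ := hF.memSchatten_and_schattenNorm_le hG hc hA hB hσ hp hP
    rw [hcpow]
    refine ⟨fun f hf => hK.ae_eq_multiplierIntegral hψ2 hP f hf,
      fun f h v hh hv => hP.ae_eq_adjoint hU hφ2 hψ2 hψtop hh hv, h1, h2,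
      hF.enorm_le hG hc hA hB hσ hp hP, fun hAB => ?_⟩
    rwa [hAB, ENNReal.one_rpow, mul_one] at h2
  · obtain ⟨h1, h2⟩ := hF.memSchatten_and_schattenNorm_le hG hc hA hB hσ le_rfl hP
    refine ⟨h1, ?_, hK.integrable_trace_density hφ2 hψ2 hφ1 hψ1
      (memLp_one_iff_integrable.1 hσ), ?_⟩
    · simpa [ENNReal.ofReal_pow hK.nonneg] using h2
    · have : Fact ((2 : ℝ≥0∞) ≠ ∞) := ⟨ENNReal.ofNat_ne_top⟩
      refine hF.hasTrace hG hc hσ hP ?_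
      filter_upwards [hK.ae_exists_repr_pair hφ2 hψ2 hφ1 hψ1] with ξ ⟨k, l, _, _, hk, hl, h⟩
      exact ⟨k, l, hk, hl, h⟩
  · exact hF.uncertainty hG hA hB hAB hK.nonneg hS hT hPS hPT h₁ h₂
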